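/- Let $Y_1,Y_2,\dots$ be independent random variables with a common distribution function $G$ that is continuous, and let $l_G=\inf\{y:G(y)>0\}$ and $r_G=\sup\{y:G(y)<1\}$ (in $[-\infty,\infty]$). The upper record values are $Y(n)=Y_{L(n)}$, where $L(1)=1$ and $L(n)=\min\{j>L(n-1):Y_j>Y_{L(n-1)}\}$ for $n\ge 2$. Let $T$ be continuous and strictly increasing on $(l_G,r_G)$ with $\tau:=T(l_G+)=\lim_{y\downarrow l_G}T(y)>-\infty$ and $T(r_G)=\lim_{y\uparrow r_G}T(y)=\infty$. Let $n,k,r$ be integers with $1\le k\le n-1$ and $r\ge 1$, and let $h$ be a real function whose derivative $h^{(k+r-1)}$ exists and is continuous on $(\tau,\infty)$. For $u,v\in(\tau,\infty)$, $u\ne v$, put $$ {}_iM_j(u,v)=\frac{\partial^{i+j}}{\partial u^i\,\partial v^j}\left(\frac{h(v)-h(u)}{v-u}\right),\qquad {}_iM'_j(u,v)=\frac{\partial^{i+j}}{\partial u^i\,\partial v^j}\left(\frac{h'(v)-h'(u)}{v-u}\right),$$ with $M_j={}_0M_j$, and let ${}_iM_j(\tau,v)=\lim_{u\downarrow\tau}{}_iM_j(u,v)$;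 a condition ${}_iM_j(\tau,v)\neq0$ means that this limit exists in $[-\infty,\infty]$ and is not $0$. Regression identities are understood in terms of the regular conditional distribution of $Y(n)$ given the two conditioning records; as always for conditional expectations, they are required for almost every pair of values with respect to the joint law of the two conditioning records. A. Let $r=1$ and suppose $M_k(\tau,T(t))\ne0$ for all $t\in(l_G,r_G)$. Then $$E\big[h^{(k)}(T(Y(n)))\,\big|\,Y(n-k)=s,\ Y(n+1)=t\big]=k\,M_{k-1}(T(s),T(t))\qquad(l_G<s<t<r_G)$$ holds if and only if, for some constant $c>0$, $$G(y)=1-e^{-c[T(y)-\tau]}\qquad(l_G<y<r_G).\qquad(*)$$ B. Let $r\ge2$, $k\ge2$, and suppose ${}_rM_{k-1}(\tau,T(t))\ne0$ for all $t\in(l_G,r_G)$. Then both $$E\big[h^{(k+r-1)}(T(Y(n)))\,\big|\,Y(n-k)=s,\ Y(n+r)=t\big]=\frac{(k+r-1)!}{(k-1)!\,(r-1)!}\;{}_{r-1}M_{k-1}(T(s),T(t))\qquad(l_G<s<t<r_G)$$ and $$E\big[h^{(k+r-1)}(T(Y(n)))\,\big|\,Y(n-k+1)=s_2,\ Y(n+r)=t\big]=\frac{(k+r-2)!}{(k-2)!\,(r-1)!}\;{}_{r-1}M'_{k-2}(T(s_2),T(t))\qquad(l_G<s_2<t<r_G)$$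 hold if and only if $(*)$ is true for some constant $c>0$. -/

import Mathlib

open MeasureTheory ProbabilityTheory Filter Topology Set

noncomputable section

/-- Index of the `(m+1)`-st upper record of the sequence `x 0, x 1, x 2, …`: the first term is a
record, and the next record is the first later term that strictly exceeds the current record.
(If there is no such term the value is the default `sInf ∅ = 0`.) -/
def recordIndex (x : ℕ → ℝ) : ℕ → ℕ
  | 0 => 0
  | m + 1 => sInf {j : ℕ | recordIndex x m < j ∧ x (recordIndex x m) < x j}

/-- The `n`-th upper record value (`n = 1, 2, …`) of the random sequence `Y 0, Y 1, …`. -/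
def recordValue {Ω : Type*} (Y : ℕ → Ω → ℝ) (n : ℕ) (ω : Ω) : ℝ :=
  Y (recordIndex (fun i => Y i ω) (n - 1)) ω

/-- Left extremity `inf {x : G x > 0}` of a distribution function, in `[-∞, ∞]`. -/
def leftExtremity (G : ℝ → ℝ) : EReal := sInf ((fun x : ℝ => (x : EReal)) '' {x : ℝ | 0 < G x})

/-- Right extremity `sup {x : G x < 1}` of a distribution function, in `[-∞, ∞]`. -/
def rightExtremity (G : ℝ → ℝ) : EReal := sSup ((fun x : ℝ => (x : EReal)) '' {x : ℝ | G x < 1})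

/-- The open interval between the two extremities. -/
def openRange (G : ℝ → ℝ) : Set ℝ :=
  {y : ℝ | leftExtremity G < (y : EReal) ∧ (y : EReal) < rightExtremity G}

/-- The mixed partial derivative `∂^(i+j) / ∂u^i ∂v^j` of the difference quotient
`(h v - h u) / (v - u)`. -/
def quotDeriv (h : ℝ → ℝ) (i j : ℕ) (u v : ℝ) : ℝ :=
  iteratedDeriv i (fun x => iteratedDeriv j (fun y => (h y - h x) / (y - x)) v) u

/-- The value at `τ+` of a function on `(τ, ∞)`, as a limit in `[-∞, ∞]`, exists and is not `0`. -/
def NonzeroRightLimit (φ : ℝ → ℝ) (τ : ℝ) : Prop :=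
  ∃ L : EReal, L ≠ 0 ∧ Tendsto (fun u => (φ u : EReal)) (𝓝[>] τ) (𝓝 L)

/-- The regression identity `E[φ(Z) | U = s, V = t] = ψ(s, t)` for `s < t` in `I`. The left side is
the mean of `φ` under the regular conditional distribution of `Z` given `(U, V) = (s, t)`; like
every conditional expectation it is determined for almost every `(s, t)` with respect to the joint
law of `(U, V)`. -/
def RegressionIdentity {Ω : Type*} [MeasurableSpace Ω] (P : Measure Ω) [IsFiniteMeasure P]
    (I : Set ℝ) (U V Z : Ω → ℝ) (φ : ℝ → ℝ) (ψ : ℝ → ℝ → ℝ) : Prop :=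
  ∀ᵐ p ∂(P.map (fun ω => (U ω, V ω))), p.1 ∈ I → p.2 ∈ I → p.1 < p.2 →
    Integrable φ (condDistrib Z (fun ω => (U ω, V ω)) P p) ∧
    ∫ z, φ z ∂(condDistrib Z (fun ω => (U ω, V ω)) P p) = ψ p.1 p.2

end

/-! Let $R=-\log(1-G)$, let $Q$ be its generalised inverse on $(0,\infty)$, and put $\theta=T\circ
Q$. By memorylessness the records, read through $R$, are partial sums of independent standard
exponentials. Hence, given $Y(n-k)=s$ and $Y(n+r)=t$, the variable $R(Y(n))$ divides $[R(s),R(t)]$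
at a Beta$(k,r)$ point (`condDistrib_recVal`). On the other side
$(h(v)-h(u))/(v-u)=\int_0^1h'(u+(v-u)x)\,dx$, and differentiation under the integral gives
${}_iM_j(u,v)=\int_0^1x^j(1-x)^ih^{(i+j+1)}(u+(v-u)x)\,dx$ (`quotDeriv_eq_betaAvg`). Write
$f=h^{(k+r-1)}$ and $B_{a,b}f(u,v)$ for `betaAvg a b f u v`. Each regression identity then says
$B_{a,b}(f\circ\theta)(p,z)=B_{a,b}f(\theta(p),\theta(z))$ for $0<p<z$, while $(*)$ says
$\theta(z)=\tau+z/c$. Affine maps preserve the division of segments, which gives one direction.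

For the converse in part A ($b=0$), differentiate in $z$: the two sides give $N/(z-p)$ and
$\theta'(z)N/(\theta(z)-\theta(p))$ with the same
$N=f(\theta(z))-(a+1)B_{a,0}f(\theta(p),\theta(z))$. The condition at $\tau$ makes $N\ne0$ for small
$p$, so $\theta'(z)=(\theta(z)-\theta(p))/(z-p)$. Letting $p\to0$ yields
$\theta'(z)=(\theta(z)-\tau)/z$, whose solutions are affine (`affine_of_betaAvg_comp_right`). In
part B differentiate in $p$: now $N$ combines $B_{a+1,b}$ and $B_{a,b}$, which is why two identities
are needed. For small $p$, $\theta'(p)$ is the slope of the chord from $p$ to $z$, so this slope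
does not vary with $p$ and equals $(\theta(z)-\tau)/z$. Since $\theta'(p)$ does not involve $z$,
neither does the ratio (`affine_of_betaAvg_comp_left`).

Two obstacles remain. The identities hold only for almost every pair, and $\theta$ is a priori only
left continuous, since $Q$ jumps where $G$ is flat. Left limits remove the first
(`betaAvg_comp_eq_of_ae`). For the second, $B(f\circ\theta)$ is continuous, even differentiable in
its left end, without regularity of $\theta$, and $Bf$ is injective in its moving end where
$N\neq0$; so $\theta$ inherits continuity and then differentiability (`continuousAt_of_comp_injOn`,
`hasDerivAt_of_comp`). -/

section records_and_beta_averages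

open scoped ENNReal Nat

/-! ### First exceedances in an i.i.d. sequence -/

/-- Prepending a term to a sequence. -/
def consSeq (a : ℝ) (x : ℕ → ℝ) : ℕ → ℝ
  | 0 => a
  | j + 1 => x j

lemma measurable_consSeq : Measurable fun p : ℝ × (ℕ → ℝ) => consSeq p.1 p.2 := by
  refine measurable_pi_lambda _ fun j => ?_
  cases j with
  | zero => exact measurable_fst
  | succ j => exact (measurable_pi_apply j).comp measurable_snd

/-- Infinite product measures are determined by finite cylinders. Padding a cylinder to an initial
block of coordinates makes its preimage a product of a condition on the head and a cylinder for the
tail. -/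
lemma map_consSeq_infinitePi (μ : Measure ℝ) [IsProbabilityMeasure μ] :
    (μ.prod (Measure.infinitePi fun _ : ℕ => μ)).map (fun p => consSeq p.1 p.2) =
      Measure.infinitePi fun _ : ℕ => μ := by
  classical
  refine Measure.eq_infinitePi _ fun s t ht => ?_
  obtain ⟨N, hN⟩ : ∃ N, s ⊆ Finset.range (N + 1) :=
    ⟨s.sup id, fun i hi => Finset.mem_range.2 (Nat.lt_succ_of_le (Finset.le_sup (f := id) hi))⟩
  set t' : ℕ → Set ℝ := fun i => if i ∈ s then t i else univ with ht'
  have ht'm : ∀ i, MeasurableSet (t' i) := by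
    intro i; simp only [ht']; split_ifs
    exacts [ht i, .univ]
  have h1 : Set.pi (s : Set ℕ) t = Set.pi (Finset.range (N + 1) : Set ℕ) t' := by
    ext x
    simp only [Set.mem_pi, ht', Finset.mem_coe]
    refine ⟨fun h i _ => ?_, fun h i hi => ?_⟩
    · split_ifs with hi
      exacts [h i hi, mem_univ _]
    · simpa [hi] using h i (hN hi)
  have h2 : ∏ i ∈ s, μ (t i) = ∏ i ∈ Finset.range (N + 1), μ (t' i) := by
    rw [← Finset.prod_subset hN (f := fun i => μ (t' i))]
    · exact Finset.prod_congr rfl fun i hi => by simp [ht', hi]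
    · intro i _ hi; simp [ht', hi]
  have h3 : (fun p : ℝ × (ℕ → ℝ) => consSeq p.1 p.2) ⁻¹'
      (Set.pi (Finset.range (N + 1) : Set ℕ) t') =
      t' 0 ×ˢ Set.pi (Finset.range N : Set ℕ) (fun i => t' (i + 1)) := by
    ext ⟨a, x⟩
    simp only [mem_preimage, Set.mem_pi, mem_prod, Finset.coe_range, mem_Iio]
    constructor
    · exact fun h => ⟨h 0 (by omega), fun i hi => h (i + 1) (by omega)⟩
    · rintro ⟨h0, h⟩ i hi
      cases i with
      | zero => exact h0
      | succ i => exact h i (by omega)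
  rw [h1, h2, Measure.map_apply measurable_consSeq
    (MeasurableSet.pi (Finset.countable_toSet _) fun i _ => ht'm i), h3, Measure.prod_prod,
    Measure.infinitePi_pi _ (fun i _ => ht'm _), Finset.prod_range_succ', mul_comm]

lemma lintegral_infinitePi_consSeq (μ : Measure ℝ) [IsProbabilityMeasure μ]
    {g : (ℕ → ℝ) → ℝ≥0∞} (hg : Measurable g) :
    ∫⁻ x, g x ∂(Measure.infinitePi fun _ : ℕ => μ) =
      ∫⁻ a, ∫⁻ x, g (consSeq a x) ∂(Measure.infinitePi fun _ : ℕ => μ) ∂μ := by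
  conv_lhs => rw [← map_consSeq_infinitePi μ, lintegral_map hg measurable_consSeq,
    lintegral_prod (fun p : ℝ × (ℕ → ℝ) => g (consSeq p.1 p.2))
      (hg.comp measurable_consSeq).aemeasurable]

lemma measurable_nat_sInf {α : Type*} [MeasurableSpace α] {S : ℕ → α → Prop}
    (hS : ∀ j, MeasurableSet {x | S j x}) : Measurable fun x => sInf {j | S j x} := by
  classical
  refine measurable_of_Iic fun n => ?_
  -- The intersection is the event that no index qualifies; there the value is the default `sInf ∅ =
  -- 0`, which lies below every `n`.
  have : (fun x => sInf {j | S j x}) ⁻¹' Iic n =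
      (⋃ j ∈ Finset.range (n + 1), {x | S j x}) ∪ ⋂ j, {x | S j x}ᶜ := by
    ext x
    simp only [mem_preimage, mem_Iic, mem_union, mem_iUnion, Finset.mem_range, mem_ofPred_eq,
      mem_iInter, mem_compl_iff, exists_prop]
    constructor
    · intro h
      by_cases hne : ∃ j, S j x
      · exact .inl ⟨_, Nat.lt_succ_of_le h, Nat.sInf_mem (s := {j | S j x}) hne⟩
      · exact .inr (not_exists.1 hne)
    · rintro (⟨j, hj, hjx⟩ | h)
      · exact (Nat.sInf_le hjx).trans (by omega)
      · have : {j | S j x} = ∅ := eq_empty_of_forall_notMem h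
        simp [this]
  rw [this]
  exact (Finset.measurableSet_biUnion _ fun j _ => hS j).union
    (MeasurableSet.iInter fun j => (hS j).compl)

lemma measurable_apply_nat {α : Type*} [MeasurableSpace α] {Y : ℕ → α → ℝ}
    (hY : ∀ i, Measurable (Y i)) {f : α → ℕ} (hf : Measurable f) :
    Measurable fun x => Y (f x) x := by
  have : Measurable fun p : ℕ × α => Y p.1 p.2 := measurable_from_prod_countable_right hY
  exact this.comp (hf.prodMk measurable_id)

/-- The index of the first term of `x` exceeding the level `w`. -/
noncomputable def firstExceed (w : ℝ) (x : ℕ → ℝ) : ℕ := sInf {j | w < x j}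

lemma measurable_firstExceed : Measurable fun p : ℝ × (ℕ → ℝ) => firstExceed p.1 p.2 :=
  measurable_nat_sInf fun j =>
    measurableSet_lt measurable_fst ((measurable_pi_apply j).comp measurable_snd)

/-- The first exceedance of the level `w`, with the part of the sequence after it. -/
noncomputable def exceedance (w : ℝ) (x : ℕ → ℝ) : ℝ × (ℕ → ℝ) :=
  (x (firstExceed w x), fun j => x (firstExceed w x + 1 + j))

lemma measurable_exceedance : Measurable fun p : ℝ × (ℕ → ℝ) => exceedance p.1 p.2 := by
  have h : ∀ i, Measurable fun p : ℝ × (ℕ → ℝ) => p.2 i :=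
    fun i => (measurable_pi_apply i).comp measurable_snd
  refine (measurable_apply_nat h measurable_firstExceed).prodMk (measurable_pi_lambda _ fun j => ?_)
  exact measurable_apply_nat h ((measurable_firstExceed.add_const 1).add_const j)

lemma exceedance_consSeq_of_lt {w a : ℝ} (h : w < a) (x : ℕ → ℝ) :
    exceedance w (consSeq a x) = (a, x) := by
  have h0 : firstExceed w (consSeq a x) = 0 :=
    Nat.sInf_eq_zero.2 (.inl (show w < consSeq a x 0 from h))
  refine Prod.ext ?_ (funext fun j => ?_)
  · simp only [exceedance, h0]; rfl
  · simp only [exceedance, h0, zero_add, add_comm 1 j]; rfl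

lemma exceedance_consSeq_of_le {w a : ℝ} (h : a ≤ w) {x : ℕ → ℝ} (hx : ∃ j, w < x j) :
    exceedance w (consSeq a x) = exceedance w x := by
  have hn : {j | w < consSeq a x j}.Nonempty := hx.imp' (· + 1) fun j hj => hj
  have h0 : firstExceed w (consSeq a x) = firstExceed w x + 1 := by
    refine le_antisymm (Nat.sInf_le ?_) ?_
    · exact Nat.sInf_mem (s := {j | w < x j}) hx
    · have h1 : w < consSeq a x (firstExceed w (consSeq a x)) := Nat.sInf_mem hn
      generalize firstExceed w (consSeq a x) = n at h1
      cases n with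
      | zero => exact absurd h1 (not_lt.2 h)
      | succ n => exact Nat.succ_le_succ (Nat.sInf_le h1)
  refine Prod.ext ?_ (funext fun j => ?_)
  · simp only [exceedance, h0]; rfl
  · simp only [exceedance, h0]
    rw [show firstExceed w x + 1 + 1 + j = (firstExceed w x + 1 + j) + 1 by ring]; rfl

lemma exists_lt_consSeq_of_le {w a : ℝ} (h : a ≤ w) {x : ℕ → ℝ} :
    (∃ j, w < consSeq a x j) ↔ ∃ j, w < x j := by
  constructor
  · rintro ⟨j, hj⟩
    cases j with
    | zero => exact absurd hj (not_lt.2 h)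
    | succ j => exact ⟨j, hj⟩
  · rintro ⟨j, hj⟩; exact ⟨j + 1, hj⟩

section renewal

variable (μ : Measure ℝ) [IsProbabilityMeasure μ]

lemma measurableSet_exists_lt (w : ℝ) : MeasurableSet {x : ℕ → ℝ | ∃ j, w < x j} := by
  rw [ofPred_exists]
  exact MeasurableSet.iUnion fun j => measurableSet_lt measurable_const (measurable_pi_apply j)

/-- First-step analysis. If the first term exceeds `w` it is the exceedance and the rest is fresh;
otherwise the exceedance is that of the tail. This gives `E = I + E * μ (Iic w)`, and the finite
last term cancels. The restriction to sequences that do exceed `w` is needed because it is not yet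
known that almost all of them do. -/
lemma lintegral_exceedance_mul {w : ℝ} {s : Set (ℝ × (ℕ → ℝ))} (hs : MeasurableSet s) :
    (∫⁻ x in {x | ∃ j, w < x j}, s.indicator (1 : ℝ × (ℕ → ℝ) → ℝ≥0∞) (exceedance w x)
        ∂(Measure.infinitePi fun _ : ℕ => μ)) * μ (Ioi w) =
      ∫⁻ a in Ioi w, ∫⁻ x, s.indicator (1 : ℝ × (ℕ → ℝ) → ℝ≥0∞) (a, x) ∂(Measure.infinitePi fun _ : ℕ => μ) ∂μ := by
  set ν := Measure.infinitePi fun _ : ℕ => μ with hν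
  set E := ∫⁻ x in {x | ∃ j, w < x j}, s.indicator (1 : ℝ × (ℕ → ℝ) → ℝ≥0∞) (exceedance w x) ∂ν with hE
  have hEfin : E ≠ ∞ := by
    have : E ≤ 1 := by
      calc E ≤ ∫⁻ _, 1 ∂ν := (setLIntegral_le_lintegral _ _).trans
            (lintegral_mono fun x => indicator_le_self' (by simp) _)
        _ = 1 := by simp
    exact ne_top_of_le_ne_top ENNReal.one_ne_top this
  have hgm : Measurable fun x => s.indicator (1 : ℝ × (ℕ → ℝ) → ℝ≥0∞) (exceedance w x) :=
    (measurable_one.indicator hs).comp (measurable_exceedance.comp measurable_prodMk_left)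
  have hrec : E = ∫⁻ a in Ioi w, ∫⁻ x, s.indicator (1 : ℝ × (ℕ → ℝ) → ℝ≥0∞) (a, x) ∂ν ∂μ + E * μ (Iic w) := by
    conv_lhs => rw [hE, ← lintegral_indicator (measurableSet_exists_lt w),
      lintegral_infinitePi_consSeq μ (hgm.indicator (measurableSet_exists_lt w)),
      ← lintegral_add_compl _ (measurableSet_Ioi (a := w))]
    congr 1
    · refine setLIntegral_congr_fun measurableSet_Ioi fun a ha => lintegral_congr fun x => ?_
      rw [indicator_of_mem (show consSeq a x ∈ {x | ∃ j, w < x j} from ⟨0, ha⟩),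
        exceedance_consSeq_of_lt ha]
    · rw [compl_Ioi, ← setLIntegral_const]
      refine setLIntegral_congr_fun measurableSet_Iic fun a ha => ?_
      rw [hE, ← lintegral_indicator (measurableSet_exists_lt w)]
      refine lintegral_congr fun x => ?_
      by_cases hx : ∃ j, w < x j
      · rw [indicator_of_mem (show x ∈ {x | ∃ j, w < x j} from hx),
          indicator_of_mem (show consSeq a x ∈ {x | ∃ j, w < x j} from
            (exists_lt_consSeq_of_le ha).2 hx), exceedance_consSeq_of_le ha hx]
      · rw [indicator_of_notMem (show x ∉ {x | ∃ j, w < x j} from hx),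
          indicator_of_notMem (show consSeq a x ∉ {x | ∃ j, w < x j} from
            fun h => hx ((exists_lt_consSeq_of_le ha).1 h))]
  have hsum : μ (Ioi w) + μ (Iic w) = 1 := by
    rw [← compl_Ioi, measure_add_measure_compl measurableSet_Ioi, measure_univ]
  have h2 : E * μ (Ioi w) + E * μ (Iic w) =
      ∫⁻ a in Ioi w, ∫⁻ x, s.indicator (1 : ℝ × (ℕ → ℝ) → ℝ≥0∞) (a, x) ∂ν ∂μ + E * μ (Iic w) := by
    rw [← mul_add, hsum, mul_one]; exact hrec
  exact (ENNReal.add_left_inj (ENNReal.mul_ne_top hEfin (measure_ne_top _ _))).1 h2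

/-- Taking `s = univ` above, the probability of an exceedance times `μ (Ioi w)` equals `μ (Ioi w)`.
-/
lemma ae_exists_lt {w : ℝ} (hw : μ (Ioi w) ≠ 0) :
    ∀ᵐ x ∂(Measure.infinitePi fun _ : ℕ => μ), ∃ j, w < x j := by
  have h := lintegral_exceedance_mul μ (w := w) MeasurableSet.univ
  simp only [indicator_univ, Pi.one_apply, lintegral_const, measure_univ, mul_one,
    Measure.restrict_apply MeasurableSet.univ, univ_inter, one_mul] at h
  have h1 : Measure.infinitePi (fun _ : ℕ => μ) {x | ∃ j, w < x j} = 1 := by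
    have := congrArg (· / μ (Ioi w)) h
    simpa [ENNReal.mul_div_cancel_right hw (measure_ne_top _ _),
      ENNReal.div_self hw (measure_ne_top _ _)] using this
  exact (prob_compl_eq_zero_iff (measurableSet_exists_lt w)).2 h1

/-- The first exceedance of a level by an i.i.d. sequence has the conditional law of one term above
the level, and the sequence starts afresh after it. -/
lemma lintegral_exceedance {w : ℝ} (hw : μ (Ioi w) ≠ 0) {g : ℝ × (ℕ → ℝ) → ℝ≥0∞}
    (hg : Measurable g) :
    ∫⁻ x, g (exceedance w x) ∂(Measure.infinitePi fun _ : ℕ => μ) =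
      (μ (Ioi w))⁻¹ *
        ∫⁻ a in Ioi w, ∫⁻ x, g (a, x) ∂(Measure.infinitePi fun _ : ℕ => μ) ∂μ := by
  set ν := Measure.infinitePi fun _ : ℕ => μ with hν
  have hm : Measurable (exceedance w) := measurable_exceedance.comp measurable_prodMk_left
  have key : ν.map (exceedance w) = (μ (Ioi w))⁻¹ • ((μ.restrict (Ioi w)).prod ν) := by
    ext s hs
    have h := lintegral_exceedance_mul μ (w := w) hs
    have hN : {x : ℕ → ℝ | ∃ j, w < x j} =ᵐ[ν] univ := eventuallyEq_univ.2 (ae_exists_lt μ hw)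
    rw [setLIntegral_congr hN, setLIntegral_univ] at h
    rw [Measure.smul_apply, smul_eq_mul, Measure.prod_apply hs, ← lintegral_indicator_one hs,
      lintegral_map (measurable_one.indicator hs) hm]
    have h' : ∫⁻ a in Ioi w, ∫⁻ x, s.indicator (1 : ℝ × (ℕ → ℝ) → ℝ≥0∞) (a, x) ∂ν ∂μ =
        ∫⁻ a in Ioi w, ν (Prod.mk a ⁻¹' s) ∂μ := by
      refine lintegral_congr fun a => ?_
      rw [← lintegral_indicator_one (measurable_prodMk_left hs)]
      rfl
    rw [← h', ← h, mul_comm, mul_assoc, ENNReal.mul_inv_cancel hw (measure_ne_top _ _), mul_one]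
  rw [← lintegral_map hg hm, key, lintegral_smul_measure, smul_eq_mul,
    lintegral_prod _ hg.aemeasurable]

end renewal

/-! ### Renewal of the sequence after each record -/

section records

variable {Ω α β : Type*} [MeasurableSpace Ω] [MeasurableSpace α] [MeasurableSpace β]

/-- The `(m+1)`-st record value. -/
noncomputable def recVal (Y : ℕ → Ω → ℝ) (m : ℕ) (ω : Ω) : ℝ :=
  Y (recordIndex (fun i => Y i ω) m) ω

/-- The terms observed after the `(m+1)`-st record. -/
noncomputable def afterRec (Y : ℕ → Ω → ℝ) (m : ℕ) (ω : Ω) : ℕ → ℝ :=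
  fun j => Y (recordIndex (fun i => Y i ω) m + 1 + j) ω

lemma measurable_recordIndex {Y : ℕ → Ω → ℝ} (hY : ∀ i, Measurable (Y i)) (m : ℕ) :
    Measurable fun ω => recordIndex (fun i => Y i ω) m := by
  induction m with
  | zero => exact measurable_const
  | succ m ih =>
    refine measurable_nat_sInf fun j => ?_
    exact (measurableSet_lt ih measurable_const).inter
      (measurableSet_lt (measurable_apply_nat hY ih) (hY j))

lemma measurable_recVal {Y : ℕ → Ω → ℝ} (hY : ∀ i, Measurable (Y i)) (m : ℕ) :
    Measurable (recVal Y m) :=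
  measurable_apply_nat hY (measurable_recordIndex hY m)

lemma exceedance_afterRec {Ω : Type*} {Y : ℕ → Ω → ℝ} {m : ℕ} {ω : Ω}
    (h : ∃ j, recVal Y m ω < afterRec Y m ω j) :
    exceedance (recVal Y m ω) (afterRec Y m ω) = (recVal Y (m + 1) ω, afterRec Y (m + 1) ω) := by
  set x : ℕ → ℝ := fun i => Y i ω
  set d := firstExceed (recVal Y m ω) (afterRec Y m ω) with hd
  have hdm : recVal Y m ω < afterRec Y m ω d :=
    Nat.sInf_mem (s := {j | recVal Y m ω < afterRec Y m ω j}) h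
  have hidx : recordIndex x (m + 1) = recordIndex x m + 1 + d := by
    have hmem : recordIndex x m + 1 + d ∈
        {j : ℕ | recordIndex x m < j ∧ x (recordIndex x m) < x j} := ⟨by omega, hdm⟩
    refine le_antisymm (Nat.sInf_le hmem) ?_
    obtain ⟨h1, h2⟩ := Nat.sInf_mem ⟨_, hmem⟩
    change _ ≤ sInf {j : ℕ | recordIndex x m < j ∧ x (recordIndex x m) < x j}
    obtain ⟨e, he⟩ := Nat.exists_eq_add_of_lt h1
    rw [he] at h2 ⊢
    have : d ≤ e := Nat.sInf_le (show recVal Y m ω < afterRec Y m ω e by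
      simpa [recVal, afterRec, x, add_right_comm] using h2)
    omega
  refine Prod.ext ?_ (funext fun j => ?_)
  · change afterRec Y m ω d = Y (recordIndex x (m + 1)) ω
    rw [hidx]; rfl
  · change afterRec Y m ω (d + 1 + j) = Y (recordIndex x (m + 1) + 1 + j) ω
    rw [hidx, show recordIndex x m + 1 + d + 1 + j = recordIndex x m + 1 + (d + 1 + j) by ring]
    rfl

/-- After the `(m+1)`-st record the sequence starts afresh, independently of that record
and of the history `H`. -/
def IsRenewal (P : Measure Ω) (Y : ℕ → Ω → ℝ) (μ : Measure ℝ) (m : ℕ) (H : Ω → α) : Prop :=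
  ∀ g : (α × ℝ) × (ℕ → ℝ) → ℝ≥0∞, Measurable g →
    ∫⁻ ω, g ((H ω, recVal Y m ω), afterRec Y m ω) ∂P =
      ∫⁻ ω, ∫⁻ x, g ((H ω, recVal Y m ω), x) ∂(Measure.infinitePi fun _ : ℕ => μ) ∂P

lemma IsRenewal.comp {P : Measure Ω} {Y : ℕ → Ω → ℝ} {μ : Measure ℝ} {m : ℕ} {H : Ω → α}
    (h : IsRenewal P Y μ m H) {f : α × ℝ → β} (hf : Measurable f) :
    IsRenewal P Y μ m fun ω => f (H ω, recVal Y m ω) := by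
  intro g hg
  exact h (fun p => g ((f p.1, p.1.2), p.2)) (hg.comp (by fun_prop))

variable {P : Measure Ω} {Y : ℕ → Ω → ℝ} {μ : Measure ℝ}
  [IsProbabilityMeasure μ] {m : ℕ} {H : Ω → α}

/-- The next record is the first exceedance of the current one by the terms that follow. These are
i.i.d. and independent of the current record and the history, so the exceedance law applies with the
level frozen. -/
lemma IsRenewal.lintegral_step (hY : ∀ i, Measurable (Y i)) (h : IsRenewal P Y μ m H)
    (hpos : ∀ᵐ ω ∂P, ∀ i, μ (Ioi (Y i ω)) ≠ 0)
    {F : ((α × ℝ) × ℝ) × (ℕ → ℝ) → ℝ≥0∞} (hF : Measurable F) :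
    ∫⁻ ω, F (((H ω, recVal Y m ω), recVal Y (m + 1) ω), afterRec Y (m + 1) ω) ∂P =
      ∫⁻ ω, (μ (Ioi (recVal Y m ω)))⁻¹ * ∫⁻ a in Ioi (recVal Y m ω),
        ∫⁻ x, F (((H ω, recVal Y m ω), a), x) ∂(Measure.infinitePi fun _ : ℕ => μ) ∂μ ∂P := by
  -- A further record exists almost surely, so `recordIndex` does not fall back on its default
  -- value. The renewal property turns the event of no further record into the same event for an
  -- i.i.d. sequence at a fixed level.
  have hex : ∀ᵐ ω ∂P, ∃ j, recVal Y m ω < afterRec Y m ω j := by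
    have hms : MeasurableSet {p : ℝ × (ℕ → ℝ) | ¬ ∃ j, p.1 < p.2 j} := by
      simp only [not_exists, ofPred_forall]
      exact MeasurableSet.iInter fun j =>
        (measurableSet_lt measurable_fst (by fun_prop : Measurable fun p : ℝ × (ℕ → ℝ) => p.2 j)).compl
    set f : ℝ × (ℕ → ℝ) → ℝ≥0∞ := {p : ℝ × (ℕ → ℝ) | ¬ ∃ j, p.1 < p.2 j}.indicator 1 with hf
    have hfm : Measurable f := measurable_one.indicator hms
    have h0 := h (fun p => f (p.1.2, p.2)) (hfm.comp (by fun_prop))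
    have h1 : ∫⁻ ω, ∫⁻ x, f (recVal Y m ω, x) ∂(Measure.infinitePi fun _ : ℕ => μ) ∂P = 0 := by
      rw [← lintegral_zero (μ := P)]
      refine lintegral_congr_ae ?_
      filter_upwards [hpos] with ω hω
      rw [← lintegral_zero (μ := Measure.infinitePi fun _ : ℕ => μ)]
      refine lintegral_congr_ae ?_
      filter_upwards [ae_exists_lt μ (hω _ : μ (Ioi (recVal Y m ω)) ≠ 0)] with x hx
      exact indicator_of_notMem (fun hc : ¬ _ => hc hx) _
    have hm : Measurable fun ω => f (recVal Y m ω, afterRec Y m ω) :=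
      hfm.comp ((measurable_recVal hY m).prodMk (measurable_pi_lambda _ fun j =>
        measurable_apply_nat hY (((measurable_recordIndex hY m).add_const 1).add_const j)))
    filter_upwards [(lintegral_eq_zero_iff hm).1 (h0.trans h1)] with ω hω
    by_contra hc
    have : f (recVal Y m ω, afterRec Y m ω) = 1 := indicator_of_mem
      (show _ ∈ {p : ℝ × (ℕ → ℝ) | ¬ ∃ j, p.1 < p.2 j} from hc) _
    simp [this] at hω
  calc _ = ∫⁻ ω, F (((H ω, recVal Y m ω), (exceedance (recVal Y m ω) (afterRec Y m ω)).1),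
          (exceedance (recVal Y m ω) (afterRec Y m ω)).2) ∂P := by
        refine lintegral_congr_ae ?_
        filter_upwards [hex] with ω hω
        rw [exceedance_afterRec hω]
    _ = ∫⁻ ω, ∫⁻ x, F (((H ω, recVal Y m ω), (exceedance (recVal Y m ω) x).1),
          (exceedance (recVal Y m ω) x).2) ∂(Measure.infinitePi fun _ : ℕ => μ) ∂P := by
        refine h (fun p => F ((p.1, (exceedance p.1.2 p.2).1), (exceedance p.1.2 p.2).2))
          (hF.comp ?_)
        have := measurable_exceedance.comp
          (show Measurable fun p : (α × ℝ) × (ℕ → ℝ) => (p.1.2, p.2) by fun_prop)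
        exact (measurable_fst.prodMk this.fst).prodMk this.snd
    _ = _ := by
        refine lintegral_congr_ae ?_
        filter_upwards [hpos] with ω hω
        exact lintegral_exceedance μ (hω _ : μ (Ioi (recVal Y m ω)) ≠ 0)
          (g := fun q => F (((H ω, recVal Y m ω), q.1), q.2)) (hF.comp (by fun_prop))

lemma IsRenewal.lintegral_succ (hY : ∀ i, Measurable (Y i)) (h : IsRenewal P Y μ m H)
    (hpos : ∀ᵐ ω ∂P, ∀ i, μ (Ioi (Y i ω)) ≠ 0)
    {F : (α × ℝ) × ℝ → ℝ≥0∞} (hF : Measurable F) :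
    ∫⁻ ω, F ((H ω, recVal Y m ω), recVal Y (m + 1) ω) ∂P =
      ∫⁻ ω, (μ (Ioi (recVal Y m ω)))⁻¹ * ∫⁻ a in Ioi (recVal Y m ω),
        F ((H ω, recVal Y m ω), a) ∂μ ∂P := by
  rw [h.lintegral_step hY hpos (F := fun p => F p.1) (hF.comp measurable_fst)]
  simp

/-- In the step formula the fresh sequence enters only through the innermost integral, so
integrating it out first leaves the one-step formula for the next record alone. -/
lemma IsRenewal.succ (hY : ∀ i, Measurable (Y i)) (h : IsRenewal P Y μ m H) (hpos : ∀ᵐ ω ∂P, ∀ i, μ (Ioi (Y i ω)) ≠ 0) :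
    IsRenewal P Y μ (m + 1) fun ω => (H ω, recVal Y m ω) := by
  intro g hg
  rw [h.lintegral_step hY hpos hg, h.lintegral_succ hY hpos (F := fun p =>
    ∫⁻ x, g (p, x) ∂(Measure.infinitePi fun _ : ℕ => μ)) hg.lintegral_prod_right']

lemma isRenewal_zero [IsProbabilityMeasure P] (hY : ∀ i, Measurable (Y i)) (hi : iIndepFun Y P)
    (hμ : ∀ i, P.map (Y i) = μ) : IsRenewal P Y μ 0 fun _ => () := by
  intro g hg
  have hmap : P.map (fun ω i => Y i ω) = Measure.infinitePi fun _ : ℕ => μ := by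
    rw [hi.map_fun_eq_infinitePi_map hY]; simp_rw [hμ]
  have hYm : Measurable fun ω i => Y i ω := measurable_pi_lambda _ hY
  have hg1 : Measurable fun x : ℕ → ℝ => g (((), x 0), fun j => x (j + 1)) := by
    refine hg.comp ?_
    fun_prop
  have h1 : ∫⁻ ω, g (((), recVal Y 0 ω), afterRec Y 0 ω) ∂P =
      ∫⁻ x, g (((), x 0), fun j => x (j + 1)) ∂(Measure.infinitePi fun _ : ℕ => μ) := by
    rw [← hmap, lintegral_map hg1 hYm]
    refine lintegral_congr fun ω => ?_
    have : afterRec Y 0 ω = fun j => Y (j + 1) ω := by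
      funext j
      change Y (0 + 1 + j) ω = _
      rw [show 0 + 1 + j = j + 1 by ring]
    rw [this]
    rfl
  rw [h1, lintegral_infinitePi_consSeq μ hg1]
  have hg2 : Measurable fun a : ℝ =>
      ∫⁻ x, g (((), a), x) ∂(Measure.infinitePi fun _ : ℕ => μ) :=
    Measurable.lintegral_prod_right' (f := fun p : ℝ × (ℕ → ℝ) => g (((), p.1), p.2))
      (hg.comp (by fun_prop))
  have h2 : ∫⁻ a, ∫⁻ x, g (((), a), x) ∂(Measure.infinitePi fun _ : ℕ => μ) ∂μ =
      ∫⁻ ω, ∫⁻ x, g (((), Y 0 ω), x) ∂(Measure.infinitePi fun _ : ℕ => μ) ∂P := by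
    rw [← hμ 0, lintegral_map (by simpa only [hμ 0] using hg2) (hY 0)]
  exact h2

end records

/-! ### Cumulative hazard and its generalised inverse -/

/-- Cumulative hazard `-log (1 - G)` of a distribution function. -/
noncomputable def cumHazard (G : ℝ → ℝ) (y : ℝ) : ℝ := -Real.log (1 - G y)

/-- The generalised inverse of the cumulative hazard. -/
noncomputable def hazardQuantile (G : ℝ → ℝ) (x : ℝ) : ℝ := sInf {y | 1 - Real.exp (-x) ≤ G y}

/-- A continuous distribution function. -/
structure IsContCDF (G : ℝ → ℝ) : Prop where
  mono : Monotone G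
  cont : Continuous G
  bot : Tendsto G atBot (𝓝 0)
  top : Tendsto G atTop (𝓝 1)

lemma exp_neg_cumHazard {G : ℝ → ℝ} {w : ℝ} (hw : G w < 1) : Real.exp (-cumHazard G w) = 1 - G w := by
  rw [cumHazard, neg_neg, Real.exp_log (by linarith)]

namespace IsContCDF

variable {G : ℝ → ℝ} (hG : IsContCDF G)
include hG

lemma nonneg (y : ℝ) : 0 ≤ G y := hG.mono.le_of_tendsto hG.bot y

lemma le_one (y : ℝ) : G y ≤ 1 := hG.mono.ge_of_tendsto hG.top y

lemma mem_openRange {y : ℝ} : y ∈ openRange G ↔ 0 < G y ∧ G y < 1 := by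
  simp only [openRange, leftExtremity, rightExtremity, mem_ofPred_eq, sInf_lt_iff, lt_sSup_iff,
    mem_image, exists_exists_and_eq_and, EReal.coe_lt_coe_iff]
  constructor
  · rintro ⟨⟨a, ha, hay⟩, b, hb, hyb⟩
    exact ⟨ha.trans_le (hG.mono hay.le), (hG.mono hyb.le).trans_lt hb⟩
  · rintro ⟨h0, h1⟩
    constructor
    · obtain ⟨a, ha, ha'⟩ := (((hG.cont.tendsto y).eventually (lt_mem_nhds h0)).filter_mono
        nhdsWithin_le_nhds |>.and (self_mem_nhdsWithin (s := Iio y))).exists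
      exact ⟨a, ha, ha'⟩
    · obtain ⟨a, ha, ha'⟩ := (((hG.cont.tendsto y).eventually (gt_mem_nhds h1)).filter_mono
        nhdsWithin_le_nhds |>.and (self_mem_nhdsWithin (s := Ioi y))).exists
      exact ⟨a, ha, ha'⟩

lemma isOpen_openRange : IsOpen (openRange G) := by
  have : openRange G = {y | 0 < G y} ∩ {y | G y < 1} := by
    ext y; exact hG.mem_openRange
  rw [this]
  exact (isOpen_lt continuous_const hG.cont).inter (isOpen_lt hG.cont continuous_const)

lemma ordConnected_openRange : (openRange G).OrdConnected := by
  refine ⟨fun x hx y hy z hz => hG.mem_openRange.2 ?_⟩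
  exact ⟨(hG.mem_openRange.1 hx).1.trans_le (hG.mono hz.1),
    (hG.mono hz.2).trans_lt (hG.mem_openRange.1 hy).2⟩

/-- Continuity of `G` makes the defining set closed, and the limits of `G` make it nonempty and
bounded below, so its infimum is attained. -/
lemma hazardQuantile_le_iff {x w : ℝ} (hx : 0 < x) :
    hazardQuantile G x ≤ w ↔ 1 - Real.exp (-x) ≤ G w := by
  have hpos : 0 < 1 - Real.exp (-x) := by simp [hx]
  have hlt : 1 - Real.exp (-x) < 1 := by simp [Real.exp_pos]
  obtain ⟨a, ha⟩ := (hG.bot.eventually (gt_mem_nhds hpos)).exists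
  obtain ⟨b, hb⟩ := (hG.top.eventually (lt_mem_nhds hlt)).exists
  have hbdd : BddBelow {y | 1 - Real.exp (-x) ≤ G y} :=
    ⟨a, fun y hy => (hG.mono.reflect_lt (ha.trans_le hy)).le⟩
  have hcl : IsClosed {y | 1 - Real.exp (-x) ≤ G y} := isClosed_le continuous_const hG.cont
  refine ⟨fun h => ?_, fun h => csInf_le hbdd h⟩
  exact (hcl.csInf_mem ⟨b, hb.le⟩ hbdd : _ ≤ G _).trans (hG.mono h)

lemma lt_hazardQuantile_iff {x w : ℝ} (hx : 0 < x) :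
    w < hazardQuantile G x ↔ G w < 1 - Real.exp (-x) := by
  rw [← not_le, hG.hazardQuantile_le_iff hx, not_le]

lemma apply_hazardQuantile {x : ℝ} (hx : 0 < x) : G (hazardQuantile G x) = 1 - Real.exp (-x) := by
  refine le_antisymm ?_ ((hG.hazardQuantile_le_iff hx).1 le_rfl)
  have h : Tendsto G (𝓝[<] (hazardQuantile G x)) (𝓝 (G (hazardQuantile G x))) :=
    (hG.cont.tendsto _).mono_left nhdsWithin_le_nhds
  refine le_of_tendsto h ?_
  filter_upwards [self_mem_nhdsWithin] with y hy
  exact ((hG.lt_hazardQuantile_iff hx).1 hy).le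

lemma cumHazard_hazardQuantile {x : ℝ} (hx : 0 < x) : cumHazard G (hazardQuantile G x) = x := by
  simp [cumHazard, hG.apply_hazardQuantile hx]

lemma hazardQuantile_mem {x : ℝ} (hx : 0 < x) : hazardQuantile G x ∈ openRange G := by
  rw [hG.mem_openRange, hG.apply_hazardQuantile hx]
  simp [hx, Real.exp_pos]

lemma cumHazard_nonneg (w : ℝ) : 0 ≤ cumHazard G w := by
  have := hG.nonneg w
  have := hG.le_one w
  exact neg_nonneg.2 (Real.log_nonpos (by linarith) (by linarith))

lemma cumHazard_pos {w : ℝ} (hw : w ∈ openRange G) : 0 < cumHazard G w := by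
  obtain ⟨h0, h1⟩ := hG.mem_openRange.1 hw
  exact neg_pos.2 (Real.log_neg (by linarith) (by linarith))

lemma lt_hazardQuantile_iff_cumHazard {x w : ℝ} (hx : 0 < x) (hw : G w < 1) :
    w < hazardQuantile G x ↔ cumHazard G w < x := by
  rw [hG.lt_hazardQuantile_iff hx, ← neg_lt_neg_iff (a := x), ← Real.exp_lt_exp (x := -x),
    exp_neg_cumHazard hw]
  constructor <;> intro <;> linarith

lemma hazardQuantile_strictMonoOn : StrictMonoOn (hazardQuantile G) (Ioi 0) := by
  intro x hx x' hx' h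
  rw [hG.lt_hazardQuantile_iff hx', hG.apply_hazardQuantile hx]
  have := Real.exp_lt_exp.2 (neg_lt_neg h)
  linarith

/-- Only left continuity is available: the inverse jumps across every interval on which `G` is
constant. -/
lemma hazardQuantile_continuousWithinAt {x : ℝ} (hx : 0 < x) :
    ContinuousWithinAt (hazardQuantile G) (Iic x) x := by
  refine tendsto_order.2 ⟨fun y hy => ?_, fun y hy => ?_⟩
  · have h1 := (hG.lt_hazardQuantile_iff hx).1 hy
    have h2 : ContinuousAt (fun x : ℝ => 1 - Real.exp (-x)) x := by fun_prop
    filter_upwards [nhdsWithin_le_nhds (h2.eventually (lt_mem_nhds h1)),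
      nhdsWithin_le_nhds (lt_mem_nhds hx)] with z hz hz0
    exact (hG.lt_hazardQuantile_iff hz0).2 hz
  · filter_upwards [nhdsWithin_le_nhds (lt_mem_nhds hx), self_mem_nhdsWithin] with z hz0 hz
    exact (hG.hazardQuantile_strictMonoOn.monotoneOn hz0 hx hz).trans_lt hy

lemma measurable_hazardQuantile : Measurable (hazardQuantile G) := by
  -- For `x ≤ 0` the defining set is the whole line, whose real infimum is the default `0`.
  have hneg : ∀ x ≤ (0 : ℝ), hazardQuantile G x = 0 := by
    intro x hx
    have : {y | 1 - Real.exp (-x) ≤ G y} = univ := by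
      refine eq_univ_of_forall fun y => ?_
      have h1 : 1 ≤ Real.exp (-x) := Real.one_le_exp (by linarith)
      have h2 := hG.nonneg y
      show 1 - Real.exp (-x) ≤ G y
      linarith
    rw [hazardQuantile, this, Real.sInf_univ]
  refine measurable_of_Iic fun w => ?_
  have : hazardQuantile G ⁻¹' Iic w =
      (Ioi 0 ∩ {x | 1 - Real.exp (-x) ≤ G w}) ∪ (Iic 0 ∩ {_x | 0 ≤ w}) := by
    ext x
    simp only [mem_preimage, mem_Iic, mem_union, mem_inter_iff, mem_Ioi, mem_ofPred_eq]
    rcases le_or_gt x 0 with h | h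
    · simp [hneg x h, h, not_lt.2 h]
    · simp [hG.hazardQuantile_le_iff h, h, not_le.2 h]
  rw [this]
  exact (measurableSet_Ioi.inter (measurableSet_le (by fun_prop) measurable_const)).union
    (measurableSet_Iic.inter (MeasurableSet.const _))

lemma measurable_cumHazard : Measurable (cumHazard G) :=
  (Real.measurable_log.comp (measurable_const.sub hG.cont.measurable)).neg

end IsContCDF

lemma lintegral_Ioi_exp_neg (c : ℝ) :
    ∫⁻ x in Ioi c, ENNReal.ofReal (Real.exp (-x)) = ENNReal.ofReal (Real.exp (-c)) := by
  rw [← ofReal_integral_eq_lintegral_ofReal (exp_neg_integrableOn_Ioi c one_pos |>.congr_fun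
    (fun x _ => by simp) measurableSet_Ioi) (ae_of_all _ fun x => (Real.exp_pos _).le),
    integral_exp_neg_Ioi]

section

variable {G : ℝ → ℝ} (hG : IsContCDF G) {μ : Measure ℝ} [IsProbabilityMeasure μ]
  (hμ : ∀ y, G y = μ.real (Iic y))
include hμ

lemma measure_Ioi_eq_ofReal (w : ℝ) : μ (Ioi w) = ENNReal.ofReal (1 - G w) := by
  rw [hμ, ← probReal_compl_eq_one_sub measurableSet_Iic, compl_Iic, ofReal_measureReal]

include hG

/-- Inverse transform sampling: the common law is the image of a standard exponential under the
hazard quantile. Tails agree because the quantile exceeds `w` exactly when the exponential exceeds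
the hazard at `w`. -/
lemma eq_map_hazardQuantile :
    μ = ((volume.restrict (Ioi 0)).withDensity fun x => ENNReal.ofReal (Real.exp (-x))).map
      (hazardQuantile G) := by
  have hp : IsProbabilityMeasure
      ((volume.restrict (Ioi (0 : ℝ))).withDensity fun x => ENNReal.ofReal (Real.exp (-x))) :=
    ⟨by rw [withDensity_apply _ .univ, Measure.restrict_univ, lintegral_Ioi_exp_neg]; simp⟩
  have hp' := Measure.isProbabilityMeasure_map (μ := (volume.restrict (Ioi (0 : ℝ))).withDensity
    fun x => ENNReal.ofReal (Real.exp (-x))) hG.measurable_hazardQuantile.aemeasurable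
  refine Measure.ext_of_Iic _ _ fun w => ?_
  rw [← compl_Ioi, prob_compl_eq_one_sub measurableSet_Ioi, prob_compl_eq_one_sub measurableSet_Ioi,
    measure_Ioi_eq_ofReal hμ, Measure.map_apply hG.measurable_hazardQuantile measurableSet_Ioi,
    withDensity_apply _ (hG.measurable_hazardQuantile measurableSet_Ioi),
    Measure.restrict_restrict (hG.measurable_hazardQuantile measurableSet_Ioi)]
  congr 1
  -- Where `G w = 1` the hazard should be infinite but `Real.log 0 = 0` makes it `0`; that case is
  -- therefore treated separately.
  rcases (hG.le_one w).lt_or_eq with h | h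
  · have : hazardQuantile G ⁻¹' Ioi w ∩ Ioi 0 = Ioi (cumHazard G w) := by
      ext x
      simp only [mem_inter_iff, mem_preimage, mem_Ioi]
      constructor
      · rintro ⟨h1, h0⟩; exact (hG.lt_hazardQuantile_iff_cumHazard h0 h).1 h1
      · intro h1
        have h0 : 0 < x := (hG.cumHazard_nonneg w).trans_lt h1
        exact ⟨(hG.lt_hazardQuantile_iff_cumHazard h0 h).2 h1, h0⟩
    rw [this, lintegral_Ioi_exp_neg, exp_neg_cumHazard h]
  · have : hazardQuantile G ⁻¹' Ioi w ∩ Ioi 0 = ∅ := by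
      refine eq_empty_of_forall_notMem fun x ⟨h1, h0⟩ => ?_
      have := (hG.lt_hazardQuantile_iff h0).1 h1
      have := Real.exp_pos (-x)
      linarith
    rw [this, h]; simp

lemma lintegral_eq_hazardQuantile {f : ℝ → ℝ≥0∞} (hf : Measurable f) :
    ∫⁻ y, f y ∂μ =
      ∫⁻ x in Ioi 0, ENNReal.ofReal (Real.exp (-x)) * f (hazardQuantile G x) := by
  conv_lhs => rw [eq_map_hazardQuantile hG hμ]
  rw [lintegral_map hf hG.measurable_hazardQuantile,
    lintegral_withDensity_eq_lintegral_mul _ (by fun_prop)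
      (show Measurable fun x => f (hazardQuantile G x) from hf.comp hG.measurable_hazardQuantile)]
  rfl

/-- The mean of `f` under the law `μ` conditioned to exceed `w`, in hazard coordinates. -/
lemma inv_mul_setLIntegral_Ioi {w : ℝ} (hw : G w < 1) {f : ℝ → ℝ≥0∞} (hf : Measurable f) :
    (μ (Ioi w))⁻¹ * ∫⁻ a in Ioi w, f a ∂μ =
      ∫⁻ x in Ioi (cumHazard G w),
        ENNReal.ofReal (Real.exp (cumHazard G w - x)) * f (hazardQuantile G x) := by
  rw [← lintegral_indicator measurableSet_Ioi,
    lintegral_eq_hazardQuantile hG hμ (hf.indicator measurableSet_Ioi),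
    measure_Ioi_eq_ofReal hμ, ← exp_neg_cumHazard hw,
    ← lintegral_const_mul' _ _ (ENNReal.inv_ne_top.2 (by simp [Real.exp_pos])),
    ← lintegral_indicator measurableSet_Ioi, ← lintegral_indicator measurableSet_Ioi]
  refine lintegral_congr fun x => ?_
  by_cases h1 : cumHazard G w < x
  · have h0 : 0 < x := (hG.cumHazard_nonneg w).trans_lt h1
    rw [indicator_of_mem (show x ∈ Ioi 0 from h0), indicator_of_mem (show x ∈ Ioi _ from h1),
      indicator_of_mem (show _ ∈ Ioi w from (hG.lt_hazardQuantile_iff_cumHazard h0 hw).2 h1),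
      ← mul_assoc, ← ENNReal.ofReal_inv_of_pos (Real.exp_pos _),
      ← ENNReal.ofReal_mul (by positivity), ← Real.exp_neg, ← Real.exp_add]
    congr 3; ring
  · rw [indicator_of_notMem (show x ∉ Ioi (cumHazard G w) from h1)]
    by_cases h0 : 0 < x
    · rw [indicator_of_mem (show x ∈ Ioi 0 from h0), indicator_of_notMem (show _ ∉ Ioi w from
        fun h => h1 ((hG.lt_hazardQuantile_iff_cumHazard h0 hw).1 h))]
      simp
    · rw [indicator_of_notMem (show x ∉ Ioi 0 from h0)]

lemma ae_lt_one : ∀ᵐ y ∂μ, G y < 1 := by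
  rw [ae_iff, ← nonpos_iff_eq_zero]
  have hm : MeasurableSet {y | ¬ G y < 1} :=
    (measurableSet_lt hG.cont.measurable measurable_const).compl
  rw [← lintegral_indicator_one hm, lintegral_eq_hazardQuantile hG hμ (measurable_one.indicator hm),
    nonpos_iff_eq_zero, ← lintegral_zero (μ := volume.restrict (Ioi (0 : ℝ)))]
  refine setLIntegral_congr_fun measurableSet_Ioi fun x hx => ?_
  rw [indicator_of_notMem, mul_zero]
  exact fun h : ¬ _ => h (hG.mem_openRange.1 (hG.hazardQuantile_mem hx)).2

end

/-! ### Erlang densities and the beta law -/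

lemma setLIntegral_Ioi_Ioi_swap (c : ℝ) {f : ℝ → ℝ → ℝ≥0∞} (hf : Measurable (Function.uncurry f)) :
    ∫⁻ x in Ioi c, ∫⁻ y in Ioi x, f x y = ∫⁻ y in Ioi c, ∫⁻ x in Ioo c y, f x y := by
  have hm : Measurable (Function.uncurry fun x y : ℝ =>
      {p : ℝ × ℝ | c < p.1 ∧ p.1 < p.2}.indicator (Function.uncurry f) (x, y)) := by
    refine hf.indicator ?_
    exact (measurableSet_lt measurable_const measurable_fst).inter
      (measurableSet_lt measurable_fst measurable_snd)
  have h := lintegral_lintegral_swap (μ := volume) (ν := volume) hm.aemeasurable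
  rw [← lintegral_indicator measurableSet_Ioi, ← lintegral_indicator measurableSet_Ioi]
  convert! h using 2 with x y
  · ext x
    by_cases hx : c < x
    · rw [indicator_of_mem (show x ∈ Ioi c from hx), ← lintegral_indicator measurableSet_Ioi]
      refine lintegral_congr fun y => ?_
      simp [indicator, hx]
    · rw [indicator_of_notMem (show x ∉ Ioi c from hx)]
      simp [indicator, hx]
  · ext y
    by_cases hy : c < y
    · rw [indicator_of_mem (show y ∈ Ioi c from hy), ← lintegral_indicator measurableSet_Ioo]
      refine lintegral_congr fun x => ?_
      simp [indicator]
    · rw [indicator_of_notMem (show y ∉ Ioi c from hy), ← lintegral_zero]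
      refine lintegral_congr fun x => (indicator_of_notMem ?_ _).symm
      rintro ⟨h1, h2⟩; exact hy (h1.trans h2)

/-- The Erlang density of order `j + 1`. -/
noncomputable def erlang (j : ℕ) (d : ℝ) : ℝ≥0∞ := ENNReal.ofReal (d ^ j / j ! * Real.exp (-d))

lemma measurable_erlang (j : ℕ) : Measurable (erlang j) := by
  unfold erlang; fun_prop

lemma erlang_pos (j : ℕ) {d : ℝ} (hd : 0 < d) : 0 < erlang j d := by
  unfold erlang; rw [ENNReal.ofReal_pos]; positivity

lemma erlang_zero (d : ℝ) : erlang 0 d = ENNReal.ofReal (Real.exp (-d)) := by simp [erlang]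

/-- Convolving an Erlang density with one more exponential: the exponential factors combine into a
constant and only a power of `x - c` is left to integrate. -/
lemma setLIntegral_erlang_mul (j : ℕ) {c y : ℝ} (h : c ≤ y) :
    ∫⁻ x in Ioo c y, erlang j (x - c) * erlang 0 (y - x) = erlang (j + 1) (y - c) := by
  have h1 : ∫⁻ x in Ioo c y, erlang j (x - c) * erlang 0 (y - x) =
      ∫⁻ x in Ioo c y, ENNReal.ofReal ((x - c) ^ j / j ! * Real.exp (-(y - c))) := by
    refine setLIntegral_congr_fun measurableSet_Ioo fun x hx => ?_
    have : 0 ≤ x - c := sub_nonneg.2 hx.1.le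
    simp only [erlang, pow_zero, Nat.factorial_zero, Nat.cast_one, div_one, one_mul]
    rw [← ENNReal.ofReal_mul (by positivity), mul_assoc, ← Real.exp_add]
    congr 3; ring
  rw [h1, setLIntegral_congr Ioo_ae_eq_Ioc, ← ofReal_integral_eq_lintegral_ofReal]
  · rw [← intervalIntegral.integral_of_le h, intervalIntegral.integral_mul_const,
      intervalIntegral.integral_div,
      intervalIntegral.integral_comp_sub_right (fun x => x ^ j) c, integral_pow, erlang]
    congr 1
    rw [Nat.factorial_succ]
    push_cast
    simp
    field_simp
  · exact (Continuous.integrableOn_Icc (by fun_prop)).mono_set Ioc_subset_Icc_self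
  · refine (ae_restrict_iff' measurableSet_Ioc).2 (ae_of_all _ fun x hx => ?_)
    have : 0 ≤ x - c := sub_nonneg.2 hx.1.le
    simp only [Pi.zero_apply]
    positivity

lemma setLIntegral_erlang_comp (a b : ℕ) (c : ℝ) {f : ℝ → ℝ → ℝ≥0∞}
    (hf : Measurable (Function.uncurry f)) :
    ∫⁻ x in Ioi c, erlang a (x - c) * ∫⁻ y in Ioi x, erlang b (y - x) * f x y =
      ∫⁻ y in Ioi c, ∫⁻ x in Ioo c y, erlang a (x - c) * erlang b (y - x) * f x y := by
  have ha : Measurable fun q : ℝ × ℝ => erlang a (q.1 - c) :=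
    (measurable_erlang a).comp (by fun_prop)
  have hb : Measurable fun q : ℝ × ℝ => erlang b (q.2 - q.1) :=
    (measurable_erlang b).comp (by fun_prop)
  have hf' : Measurable fun q : ℝ × ℝ => f q.1 q.2 := hf
  have hm : Measurable fun q : ℝ × ℝ => erlang a (q.1 - c) * erlang b (q.2 - q.1) * f q.1 q.2 :=
    (ha.mul hb).mul hf'
  rw [← setLIntegral_Ioi_Ioi_swap c (f := fun x y => erlang a (x - c) * erlang b (y - x) * f x y)
    hm]
  refine lintegral_congr fun x => ?_
  have hb' : Measurable fun y : ℝ => erlang b (y - x) := (measurable_erlang b).comp (by fun_prop)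
  have hf'' : Measurable fun y : ℝ => f x y := hf'.comp measurable_prodMk_left
  have hm' : Measurable fun y => erlang b (y - x) * f x y := hb'.mul hf''
  rw [← lintegral_const_mul _ hm']
  simp only [mul_assoc]

lemma setLIntegral_erlang_comp_zero (a : ℕ) (c : ℝ) {f : ℝ → ℝ≥0∞} (hf : Measurable f) :
    ∫⁻ x in Ioi c, erlang a (x - c) * ∫⁻ y in Ioi x, erlang 0 (y - x) * f y =
      ∫⁻ y in Ioi c, erlang (a + 1) (y - c) * f y := by
  rw [setLIntegral_erlang_comp a 0 c (f := fun _ y => f y) (hf.comp measurable_snd)]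
  refine setLIntegral_congr_fun measurableSet_Ioi fun y hy => ?_
  have ha : Measurable fun x : ℝ => erlang a (x - c) := (measurable_erlang a).comp (by fun_prop)
  have hb : Measurable fun x : ℝ => erlang 0 (y - x) := (measurable_erlang 0).comp (by fun_prop)
  have hm : Measurable fun x : ℝ => erlang a (x - c) * erlang 0 (y - x) := ha.mul hb
  rw [lintegral_mul_const _ hm, setLIntegral_erlang_mul a (le_of_lt hy)]

/-- The beta law with parameters `a + 1` and `b + 1`. -/
noncomputable def betaLaw (a b : ℕ) : Measure ℝ :=
  (volume.restrict (Ioo 0 1)).withDensity fun x =>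
    ENNReal.ofReal ((a + b + 1)! / (a ! * b !) * (x ^ a * (1 - x) ^ b))

instance (a b : ℕ) : IsFiniteMeasure (betaLaw a b) := by
  refine isFiniteMeasure_withDensity_ofReal (Integrable.hasFiniteIntegral ?_)
  exact (Continuous.integrableOn_Icc (by fun_prop)).mono_set Ioo_subset_Icc_self

lemma lintegral_betaLaw (a b : ℕ) {f : ℝ → ℝ≥0∞} (hf : Measurable f) :
    ∫⁻ x, f x ∂(betaLaw a b) = ∫⁻ x in Ioo 0 1,
      ENNReal.ofReal ((a + b + 1)! / (a ! * b !) * (x ^ a * (1 - x) ^ b)) * f x := by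
  rw [betaLaw, lintegral_withDensity_eq_lintegral_mul _ (by fun_prop) hf]
  rfl

/-- Two consecutive independent Erlang increments are described by their sum, which is Erlang, and
the proportion taken by the first, which is beta and independent of the sum. The substitution is `q
= p + (z - p) * x`. -/
lemma setLIntegral_erlang_mul_erlang (a b : ℕ) {p z : ℝ} (h : p < z) {f : ℝ → ℝ≥0∞}
    (hf : Measurable f) :
    ∫⁻ q in Ioo p z, erlang a (q - p) * erlang b (z - q) * f q =
      erlang (a + b + 1) (z - p) * ∫⁻ x, f (p + (z - p) * x) ∂(betaLaw a b) := by
  have hd : 0 < z - p := sub_pos.2 h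
  have himg : (fun x => p + (z - p) * x) '' Ioo 0 1 = Ioo p z := by
    have := image_affine_Ioo hd p 0 1
    simpa [add_comm] using this
  rw [lintegral_betaLaw a b (f := fun x => f (p + (z - p) * x)) (hf.comp (by fun_prop)), ← himg,
    lintegral_image_eq_lintegral_abs_deriv_mul measurableSet_Ioo
      (f' := fun _ => z - p) (fun x _ => by
        simpa using (((hasDerivAt_id x).const_mul (z - p)).const_add p).hasDerivWithinAt)
      (fun x _ y _ hxy => by simpa [hd.ne'] using hxy),
    ← lintegral_const_mul _ (by fun_prop)]
  refine setLIntegral_congr_fun measurableSet_Ioo fun x hx => ?_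
  have h0 : 0 ≤ x := hx.1.le
  have h1 : 0 ≤ 1 - x := sub_nonneg.2 hx.2.le
  simp only [erlang, ← mul_assoc]
  congr 1
  have e1 : p + (z - p) * x - p = (z - p) * x := by ring
  have e2 : z - (p + (z - p) * x) = (z - p) * (1 - x) := by ring
  rw [e1, e2, abs_of_pos hd, ← ENNReal.ofReal_mul (by positivity),
    ← ENNReal.ofReal_mul (by positivity), ← ENNReal.ofReal_mul (by positivity)]
  congr 1
  have e3 : Real.exp (-(z - p)) =
      Real.exp (-((z - p) * x)) * Real.exp (-((z - p) * (1 - x))) := by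
    rw [← Real.exp_add]; congr 1; ring
  rw [e3, mul_pow, mul_pow]
  field_simp
  ring

/-! ### Laws of record values in hazard coordinates -/

section

variable {Ω α : Type*} [MeasurableSpace Ω] [MeasurableSpace α] {P : Measure Ω}
  {Y : ℕ → Ω → ℝ} {μ : Measure ℝ} [IsProbabilityMeasure μ] {G : ℝ → ℝ} {m : ℕ} {H : Ω → α}

lemma IsRenewal.lintegral_succ_erlang (h : IsRenewal P Y μ m H) (hY : ∀ i, Measurable (Y i))
    (hG : IsContCDF G) (hμ : ∀ y, G y = μ.real (Iic y)) (hlt : ∀ᵐ ω ∂P, ∀ i, G (Y i ω) < 1)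
    {F : (α × ℝ) × ℝ → ℝ≥0∞} (hF : Measurable F) :
    ∫⁻ ω, F ((H ω, recVal Y m ω), recVal Y (m + 1) ω) ∂P =
      ∫⁻ ω, (∫⁻ x in Ioi (cumHazard G (recVal Y m ω)), erlang 0 (x - cumHazard G (recVal Y m ω)) *
        F ((H ω, recVal Y m ω), hazardQuantile G x)) ∂P := by
  have hpos : ∀ᵐ ω ∂P, ∀ i, μ (Ioi (Y i ω)) ≠ 0 := by
    filter_upwards [hlt] with ω hω i
    rw [measure_Ioi_eq_ofReal hμ]
    simpa using hω i
  rw [h.lintegral_succ hY hpos hF]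
  refine lintegral_congr_ae ?_
  filter_upwards [hlt] with ω hω
  have hω' : G (recVal Y m ω) < 1 := hω _
  rw [inv_mul_setLIntegral_Ioi hG hμ hω'
    (f := fun a => F ((H ω, recVal Y m ω), a)) (hF.comp measurable_prodMk_left)]
  simp only [erlang_zero, neg_sub]

/-- The history retains the record of index `m` but drops the records between it and the current
one, since only the two end records are conditioned on. -/
lemma IsRenewal.add (h : IsRenewal P Y μ m H) (hY : ∀ i, Measurable (Y i))
    (hμ : ∀ y, G y = μ.real (Iic y)) (hlt : ∀ᵐ ω ∂P, ∀ i, G (Y i ω) < 1) (j : ℕ) :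
    IsRenewal P Y μ (m + j + 1) fun ω => (H ω, recVal Y m ω) := by
  have hpos : ∀ᵐ ω ∂P, ∀ i, μ (Ioi (Y i ω)) ≠ 0 := by
    filter_upwards [hlt] with ω hω i
    rw [measure_Ioi_eq_ofReal hμ]
    simpa using hω i
  induction j with
  | zero => exact h.succ hY hpos
  | succ j ih => exact (ih.succ hY hpos).comp (f := fun p => p.1.1) (by fun_prop)

lemma measurable_erlang_kernel (hG : IsContCDF G) (j : ℕ) {r : α → ℝ} (hr : Measurable r)
    {F : α × ℝ → ℝ≥0∞} (hF : Measurable F) :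
    Measurable fun p : α => ∫⁻ y in Ioi (cumHazard G (r p)),
      erlang j (y - cumHazard G (r p)) * F (p, hazardQuantile G y) := by
  have h1 : Measurable fun q : α × ℝ => {q : α × ℝ | cumHazard G (r q.1) < q.2}.indicator
        (fun q => erlang j (q.2 - cumHazard G (r q.1)) * F (q.1, hazardQuantile G q.2)) q := by
    have hR : Measurable fun q : α × ℝ => cumHazard G (r q.1) :=
      hG.measurable_cumHazard.comp (hr.comp measurable_fst)
    refine Measurable.indicator ?_ (measurableSet_lt hR measurable_snd)
    exact ((measurable_erlang j).comp (measurable_snd.sub hR)).mul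
      (hF.comp (measurable_fst.prodMk (hG.measurable_hazardQuantile.comp measurable_snd)))
  convert! h1.lintegral_prod_right' (ν := volume) using 2 with p
  rw [← lintegral_indicator measurableSet_Ioi]
  rfl

/-- In hazard coordinates, the difference of two record values has an Erlang law. -/
lemma IsRenewal.lintegral_add_erlang (h : IsRenewal P Y μ m H) (hY : ∀ i, Measurable (Y i))
    (hG : IsContCDF G) (hμ : ∀ y, G y = μ.real (Iic y)) (hlt : ∀ᵐ ω ∂P, ∀ i, G (Y i ω) < 1)
    (j : ℕ) {F : (α × ℝ) × ℝ → ℝ≥0∞} (hF : Measurable F) :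
    ∫⁻ ω, F ((H ω, recVal Y m ω), recVal Y (m + j + 1) ω) ∂P =
      ∫⁻ ω, (∫⁻ x in Ioi (cumHazard G (recVal Y m ω)), erlang j (x - cumHazard G (recVal Y m ω)) *
        F ((H ω, recVal Y m ω), hazardQuantile G x)) ∂P := by
  induction j generalizing F with
  | zero => exact h.lintegral_succ_erlang hY hG hμ hlt hF
  | succ j ih =>
    -- The last increment is integrated out first; the induction hypothesis then handles the
    -- remaining `j + 1` increments, and the Erlang convolution merges the two.
    have h1 := (h.add hY hμ hlt j).lintegral_succ_erlang hY hG hμ hlt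
      (F := fun p => F (p.1.1, p.2)) (hF.comp (by fun_prop))
    refine h1.trans ((ih (measurable_erlang_kernel hG 0 measurable_snd
      (F := fun q : ((α × ℝ) × ℝ) × ℝ => F (q.1.1, q.2)) (hF.comp (by fun_prop)))).trans (lintegral_congr fun ω => ?_))
    simp only
    set c := cumHazard G (recVal Y m ω) with hc
    have hc0 : 0 ≤ c := hG.cumHazard_nonneg _
    have hFm : Measurable fun y => F ((H ω, recVal Y m ω), hazardQuantile G y) :=
      hF.comp (measurable_prodMk_left.comp hG.measurable_hazardQuantile)
    rw [← setLIntegral_erlang_comp_zero j c hFm]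
    refine setLIntegral_congr_fun measurableSet_Ioi fun x hx => ?_
    simp only [hG.cumHazard_hazardQuantile (hc0.trans_lt hx)]

lemma isRenewal_unit [IsProbabilityMeasure P] (hY : ∀ i, Measurable (Y i)) (hi : iIndepFun Y P)
    (hPμ : ∀ i, P.map (Y i) = μ) (hμ : ∀ y, G y = μ.real (Iic y))
    (hlt : ∀ᵐ ω ∂P, ∀ i, G (Y i ω) < 1) (m : ℕ) : IsRenewal P Y μ m fun _ => () := by
  have h0 := isRenewal_zero hY hi hPμ
  cases m with
  | zero => exact h0
  | succ m => simpa using (h0.add hY hμ hlt m).comp (f := fun _ => ()) measurable_const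

lemma lintegral_recVal [IsProbabilityMeasure P] (hY : ∀ i, Measurable (Y i)) (hi : iIndepFun Y P)
    (hPμ : ∀ i, P.map (Y i) = μ) (hG : IsContCDF G) (hμ : ∀ y, G y = μ.real (Iic y))
    (hlt : ∀ᵐ ω ∂P, ∀ i, G (Y i ω) < 1) (m : ℕ) {f : ℝ → ℝ≥0∞} (hf : Measurable f) :
    ∫⁻ ω, f (recVal Y m ω) ∂P = ∫⁻ x in Ioi 0, erlang m x * f (hazardQuantile G x) := by
  induction m generalizing f with
  | zero =>
    change ∫⁻ ω, f (Y 0 ω) ∂P = _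
    rw [← lintegral_map hf (hY 0), hPμ, lintegral_eq_hazardQuantile hG hμ hf]
    simp only [erlang_zero]
  | succ m ih =>
    have hm := isRenewal_unit hY hi hPμ hμ hlt m
    have h1 := hm.lintegral_succ_erlang hY hG hμ hlt (F := fun p => f p.2) (by fun_prop)
    have hK : Measurable fun w => ∫⁻ y in Ioi (cumHazard G w),
        erlang 0 (y - cumHazard G w) * f (hazardQuantile G y) :=
      measurable_erlang_kernel hG 0 measurable_id (F := fun p => f p.2) (by fun_prop)
    refine h1.trans ((ih hK).trans ?_)
    have hFm : Measurable fun y => f (hazardQuantile G y) := hf.comp hG.measurable_hazardQuantile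
    have h2 := setLIntegral_erlang_comp_zero m 0 hFm
    simp only [sub_zero] at h2
    rw [← h2]
    refine setLIntegral_congr_fun measurableSet_Ioi fun x hx => ?_
    simp only [hG.cumHazard_hazardQuantile hx]

end

/-! ### Conditional law of a record between two others -/

/-- The point between `s` and `t` that divides their cumulative hazards in the ratio `x : 1 - x`. -/
noncomputable def hazardInterp (G : ℝ → ℝ) (s t x : ℝ) : ℝ :=
  hazardQuantile G (cumHazard G s + (cumHazard G t - cumHazard G s) * x)

lemma IsContCDF.measurable_hazardInterp {G : ℝ → ℝ} (hG : IsContCDF G) {α : Type*}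
    [MeasurableSpace α] {f g h : α → ℝ} (hf : Measurable f) (hg : Measurable g)
    (hh : Measurable h) : Measurable fun q => hazardInterp G (f q) (g q) (h q) := by
  have h1 : Measurable fun q => cumHazard G (f q) := hG.measurable_cumHazard.comp hf
  have h2 : Measurable fun q => cumHazard G (g q) := hG.measurable_cumHazard.comp hg
  have h3 : Measurable fun q => cumHazard G (f q) + (cumHazard G (g q) - cumHazard G (f q)) * h q :=
    h1.add ((h2.sub h1).mul hh)
  exact hG.measurable_hazardQuantile.comp h3

/-- The conditional law of a record value given an earlier and a later one. -/
noncomputable def recordKernel (G : ℝ → ℝ) (a b : ℕ) : Kernel (ℝ × ℝ) ℝ :=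
  (Kernel.id ×ₖ Kernel.const (ℝ × ℝ) (betaLaw a b)).map
    fun q => hazardInterp G q.1.1 q.1.2 q.2

instance (G : ℝ → ℝ) (a b : ℕ) : IsFiniteKernel (recordKernel G a b) := by
  unfold recordKernel; infer_instance

lemma recordKernel_apply {G : ℝ → ℝ} (hG : IsContCDF G) (a b : ℕ) (p : ℝ × ℝ) :
    recordKernel G a b p = (betaLaw a b).map (hazardInterp G p.1 p.2) := by
  have h1 : (Kernel.id ×ₖ Kernel.const (ℝ × ℝ) (betaLaw a b)) p =
      (betaLaw a b).map (Prod.mk p) := by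
    rw [Kernel.prod_apply, Kernel.id_apply, Kernel.const_apply, Measure.dirac_prod]
  have h2 : Measurable (Prod.mk p : ℝ → (ℝ × ℝ) × ℝ) := measurable_prodMk_left
  have h3 : Measurable fun q : (ℝ × ℝ) × ℝ => hazardInterp G q.1.1 q.1.2 q.2 :=
    hG.measurable_hazardInterp measurable_fst.fst measurable_fst.snd measurable_snd
  rw [recordKernel, Kernel.map_apply _ h3, h1, Measure.map_map h3 h2]
  rfl

lemma setLIntegral_erlang_comp_betaLaw (a b : ℕ) (c : ℝ) {f : ℝ → ℝ → ℝ≥0∞}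
    (hf : Measurable (Function.uncurry f)) :
    ∫⁻ x in Ioi c, erlang a (x - c) * ∫⁻ y in Ioi x, erlang b (y - x) * f x y =
      ∫⁻ y in Ioi c, erlang (a + b + 1) (y - c) * ∫⁻ x, f (c + (y - c) * x) y ∂(betaLaw a b) := by
  rw [setLIntegral_erlang_comp a b c hf]
  refine setLIntegral_congr_fun measurableSet_Ioi fun y hy => ?_
  have hfy : Measurable fun x : ℝ => f x y := hf.comp measurable_prodMk_right
  exact setLIntegral_erlang_mul_erlang a b hy hfy

section

variable {Ω : Type*} [MeasurableSpace Ω] {P : Measure Ω} [IsProbabilityMeasure P]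
  {Y : ℕ → Ω → ℝ} {μ : Measure ℝ} [IsProbabilityMeasure μ] {G : ℝ → ℝ}

lemma lintegral_recVal_pair (hY : ∀ i, Measurable (Y i)) (hi : iIndepFun Y P)
    (hPμ : ∀ i, P.map (Y i) = μ) (hG : IsContCDF G) (hμ : ∀ y, G y = μ.real (Iic y))
    (hlt : ∀ᵐ ω ∂P, ∀ i, G (Y i ω) < 1) (m j : ℕ) {g : ℝ × ℝ → ℝ≥0∞} (hg : Measurable g) :
    ∫⁻ ω, g (recVal Y m ω, recVal Y (m + j + 1) ω) ∂P =
      ∫⁻ p in Ioi 0, erlang m p *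
        ∫⁻ z in Ioi p, erlang j (z - p) * g (hazardQuantile G p, hazardQuantile G z) := by
  have h := isRenewal_unit hY hi hPμ hμ hlt m
  rw [h.lintegral_add_erlang hY hG hμ hlt j (F := fun q => g (q.1.2, q.2)) (hg.comp (by fun_prop)),
    lintegral_recVal hY hi hPμ hG hμ hlt m (f := fun w => ∫⁻ z in Ioi (cumHazard G w),
      erlang j (z - cumHazard G w) * g (w, hazardQuantile G z))
      (measurable_erlang_kernel hG j measurable_id hg)]
  refine setLIntegral_congr_fun measurableSet_Ioi fun p hp => ?_
  simp only [hG.cumHazard_hazardQuantile hp]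

/-- The left side is computed by the two increments around the middle record, the right side by a
single increment between the outer records. The beta splitting of Erlang increments identifies them.
This is the disintegration that characterises the conditional law. -/
lemma lintegral_recVal_triple (hY : ∀ i, Measurable (Y i)) (hi : iIndepFun Y P)
    (hPμ : ∀ i, P.map (Y i) = μ) (hG : IsContCDF G) (hμ : ∀ y, G y = μ.real (Iic y))
    (hlt : ∀ᵐ ω ∂P, ∀ i, G (Y i ω) < 1) (m a b : ℕ) {g : (ℝ × ℝ) × ℝ → ℝ≥0∞}
    (hg : Measurable g) :
    ∫⁻ ω, g ((recVal Y m ω, recVal Y (m + a + 1 + b + 1) ω), recVal Y (m + a + 1) ω) ∂P =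
      ∫⁻ ω, ∫⁻ x, g ((recVal Y m ω, recVal Y (m + a + 1 + b + 1) ω),
        hazardInterp G (recVal Y m ω) (recVal Y (m + a + 1 + b + 1) ω) x) ∂(betaLaw a b) ∂P := by
  have h := isRenewal_unit hY hi hPμ hμ hlt m
  have h1 := (h.add hY hμ hlt a).lintegral_add_erlang hY hG hμ hlt b
    (F := fun q => g ((q.1.1.2, q.2), q.1.2)) (hg.comp (by fun_prop))
  have h2 := h.lintegral_add_erlang hY hG hμ hlt a
    (F := fun q => ∫⁻ y in Ioi (cumHazard G q.2),
      erlang b (y - cumHazard G q.2) * g ((q.1.2, hazardQuantile G y), q.2))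
    (measurable_erlang_kernel hG b measurable_snd
      (F := fun r : ((Unit × ℝ) × ℝ) × ℝ => g ((r.1.1.2, r.2), r.1.2)) (hg.comp (by fun_prop)))
  have hK : Measurable fun q : (Unit × ℝ) × ℝ =>
      ∫⁻ x, g ((q.1.2, q.2), hazardInterp G q.1.2 q.2 x) ∂(betaLaw a b) := by
    have e2 : Measurable fun r : ((Unit × ℝ) × ℝ) × ℝ => (r.1.1.2, r.1.2) := by fun_prop
    have e3 : Measurable fun r : ((Unit × ℝ) × ℝ) × ℝ => hazardInterp G r.1.1.2 r.1.2 r.2 :=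
      hG.measurable_hazardInterp (by fun_prop) (by fun_prop) (by fun_prop)
    have e4 : Measurable fun r : ((Unit × ℝ) × ℝ) × ℝ =>
        g ((r.1.1.2, r.1.2), hazardInterp G r.1.1.2 r.1.2 r.2) := hg.comp (e2.prodMk e3)
    exact e4.lintegral_prod_right'
  have h3 := h.lintegral_add_erlang hY hG hμ hlt (a + b + 1) hK
  rw [show m + (a + b + 1) + 1 = m + a + 1 + b + 1 by ring] at h3
  refine (h1.trans h2).trans ((lintegral_congr fun ω => ?_).trans h3.symm)
  simp only
  set w := recVal Y m ω
  set c := cumHazard G w with hc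
  have hc0 : 0 ≤ c := hG.cumHazard_nonneg _
  have hQ := hG.measurable_hazardQuantile
  have hgm : Measurable fun q : ℝ × ℝ => g ((w, hazardQuantile G q.2), hazardQuantile G q.1) :=
    hg.comp ((measurable_const.prodMk (hQ.comp measurable_snd)).prodMk (hQ.comp measurable_fst))
  have h4 := setLIntegral_erlang_comp_betaLaw a b c
    (f := fun x y => g ((w, hazardQuantile G y), hazardQuantile G x)) hgm
  have h5 : ∀ x ∈ Ioi c, erlang a (x - c) * ∫⁻ y in Ioi (cumHazard G (hazardQuantile G x)),
      erlang b (y - cumHazard G (hazardQuantile G x)) *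
        g ((w, hazardQuantile G y), hazardQuantile G x) =
      erlang a (x - c) * ∫⁻ y in Ioi x, erlang b (y - x) *
        g ((w, hazardQuantile G y), hazardQuantile G x) := by
    intro x hx
    rw [hG.cumHazard_hazardQuantile (hc0.trans_lt hx)]
  have h6 : ∀ y ∈ Ioi c, erlang (a + b + 1) (y - c) * ∫⁻ x, g ((w, hazardQuantile G y),
        hazardQuantile G (c + (y - c) * x)) ∂(betaLaw a b) =
      erlang (a + b + 1) (y - c) * ∫⁻ x, g ((w, hazardQuantile G y),
        hazardInterp G w (hazardQuantile G y) x) ∂(betaLaw a b) := by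
    intro y hy
    simp only [hazardInterp, hG.cumHazard_hazardQuantile (hc0.trans_lt hy)]
    rfl
  rw [setLIntegral_congr_fun measurableSet_Ioi h5, h4,
    setLIntegral_congr_fun measurableSet_Ioi h6]

/-- The conditional law of a record value given an earlier and a later one is a beta law in
hazard coordinates. -/
lemma condDistrib_recVal (hY : ∀ i, Measurable (Y i)) (hi : iIndepFun Y P)
    (hPμ : ∀ i, P.map (Y i) = μ) (hG : IsContCDF G) (hμ : ∀ y, G y = μ.real (Iic y))
    (hlt : ∀ᵐ ω ∂P, ∀ i, G (Y i ω) < 1) (m a b : ℕ) :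
    condDistrib (recVal Y (m + a + 1))
        (fun ω => (recVal Y m ω, recVal Y (m + a + 1 + b + 1) ω)) P
      =ᵐ[P.map fun ω => (recVal Y m ω, recVal Y (m + a + 1 + b + 1) ω)]
        recordKernel G a b := by
  have hUV : Measurable fun ω => (recVal Y m ω, recVal Y (m + a + 1 + b + 1) ω) :=
    (measurable_recVal hY _).prodMk (measurable_recVal hY _)
  have hZ := measurable_recVal hY (m + a + 1)
  refine condDistrib_ae_eq_of_measure_eq_compProd _ hZ.aemeasurable ?_
  refine Measure.ext_of_lintegral _ fun g hg => ?_
  have hK : Measurable fun q : ℝ × ℝ => ∫⁻ z, g (q, z) ∂(recordKernel G a b q) :=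
    hg.lintegral_kernel_prod_right'
  rw [lintegral_map hg (hUV.prodMk hZ), Measure.lintegral_compProd hg, lintegral_map hK hUV,
    lintegral_recVal_triple hY hi hPμ hG hμ hlt m a b hg]
  refine lintegral_congr fun ω => ?_
  have hm : Measurable (hazardInterp G (recVal Y m ω) (recVal Y (m + a + 1 + b + 1) ω)) :=
    hG.measurable_hazardInterp measurable_const measurable_const measurable_id
  have hg' : Measurable fun z => g ((recVal Y m ω, recVal Y (m + a + 1 + b + 1) ω), z) :=
    hg.comp measurable_prodMk_left
  rw [recordKernel_apply hG, lintegral_map hg' hm]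

/-- The joint law of two record values dominates the product of Lebesgue measures in hazard
coordinates. -/
lemma ae_ae_of_ae_map_recVal (hY : ∀ i, Measurable (Y i)) (hi : iIndepFun Y P)
    (hPμ : ∀ i, P.map (Y i) = μ) (hG : IsContCDF G) (hμ : ∀ y, G y = μ.real (Iic y))
    (hlt : ∀ᵐ ω ∂P, ∀ i, G (Y i ω) < 1) (m j : ℕ) {p : ℝ × ℝ → Prop}
    (hp : ∀ᵐ q ∂(P.map fun ω => (recVal Y m ω, recVal Y (m + j + 1) ω)), p q) :
    ∀ᵐ s ∂(volume.restrict (Ioi (0 : ℝ))), ∀ᵐ t ∂(volume.restrict (Ioi s)),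
      p (hazardQuantile G s, hazardQuantile G t) := by
  have hUV : Measurable fun ω => (recVal Y m ω, recVal Y (m + j + 1) ω) :=
    (measurable_recVal hY _).prodMk (measurable_recVal hY _)
  obtain ⟨N, hN, hNm, hN0⟩ := exists_measurable_superset_of_null (ae_iff.1 hp)
  have hind : Measurable (N.indicator (1 : ℝ × ℝ → ℝ≥0∞)) := measurable_one.indicator hNm
  rw [← lintegral_indicator_one hNm, lintegral_map hind hUV,
    lintegral_recVal_pair hY hi hPμ hG hμ hlt m j hind] at hN0
  have hQ := hG.measurable_hazardQuantile
  have hinner : Measurable fun s => ∫⁻ t in Ioi s, erlang j (t - s) *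
      N.indicator (1 : ℝ × ℝ → ℝ≥0∞) (hazardQuantile G s, hazardQuantile G t) := by
    have h1 : Measurable fun q : ℝ × ℝ => {q : ℝ × ℝ | q.1 < q.2}.indicator
        (fun q => erlang j (q.2 - q.1) *
          N.indicator (1 : ℝ × ℝ → ℝ≥0∞) (hazardQuantile G q.1, hazardQuantile G q.2)) q := by
      refine Measurable.indicator ?_ (measurableSet_lt measurable_fst measurable_snd)
      exact ((measurable_erlang j).comp (measurable_snd.sub measurable_fst)).mul
        (hind.comp ((hQ.comp measurable_fst).prodMk (hQ.comp measurable_snd)))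
    convert! h1.lintegral_prod_right' (ν := volume) using 2 with s
    rw [← lintegral_indicator measurableSet_Ioi]
    rfl
  have houter : Measurable fun s => erlang m s * ∫⁻ t in Ioi s, erlang j (t - s) *
      N.indicator (1 : ℝ × ℝ → ℝ≥0∞) (hazardQuantile G s, hazardQuantile G t) :=
    (measurable_erlang m).mul hinner
  rw [lintegral_eq_zero_iff houter] at hN0
  filter_upwards [hN0, ae_restrict_mem measurableSet_Ioi] with s hs hs0
  -- Erlang densities are strictly positive on the positive half-line, so a vanishing product forces
  -- the other factor to vanish.
  have hs1 := (mul_eq_zero.1 hs).resolve_left (erlang_pos m hs0).ne'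
  have hm : Measurable fun t : ℝ => erlang j (t - s) *
      N.indicator (1 : ℝ × ℝ → ℝ≥0∞) (hazardQuantile G s, hazardQuantile G t) :=
    ((measurable_erlang j).comp (by fun_prop)).mul (hind.comp (measurable_const.prodMk hQ))
  rw [lintegral_eq_zero_iff hm] at hs1
  filter_upwards [hs1, ae_restrict_mem measurableSet_Ioi] with t ht hst
  have ht1 := (mul_eq_zero.1 ht).resolve_left (erlang_pos j (sub_pos.2 hst)).ne'
  by_contra hc
  have : N.indicator (1 : ℝ × ℝ → ℝ≥0∞) (hazardQuantile G s, hazardQuantile G t) = 1 :=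
    indicator_of_mem (hN hc) _
  rw [this] at ht1
  exact one_ne_zero ht1

end

/-! ### Beta averages and derivatives of the difference quotient -/

/-- The (unnormalised) mean of `f` over the segment from `u` to `v` under the beta weight with
parameters `a + 1` and `b + 1`. -/
noncomputable def betaAvg (a b : ℕ) (f : ℝ → ℝ) (u v : ℝ) : ℝ :=
  ∫ x in (0 : ℝ)..1, x ^ a * (1 - x) ^ b * f (u + (v - u) * x)

lemma betaAvg_swap (a b : ℕ) (f : ℝ → ℝ) (u v : ℝ) : betaAvg a b f u v = betaAvg b a f v u := by
  have h := intervalIntegral.integral_comp_sub_left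
    (fun x => x ^ a * (1 - x) ^ b * f (u + (v - u) * x)) (1 : ℝ) (a := 0) (b := 1)
  simp only [sub_self, sub_zero] at h
  rw [betaAvg, ← h, betaAvg]
  refine intervalIntegral.integral_congr fun x _ => ?_
  simp only [sub_sub_cancel]
  rw [show u + (v - u) * (1 - x) = v + (u - v) * x by ring]
  ring

lemma pow_mul_betaAvg (a b : ℕ) (f : ℝ → ℝ) {u v : ℝ} (h : u ≠ v) :
    (v - u) ^ (a + b + 1) * betaAvg a b f u v = ∫ x in u..v, (x - u) ^ a * (v - x) ^ b * f x := by
  have hd : v - u ≠ 0 := sub_ne_zero.2 h.symm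
  have h1 := intervalIntegral.integral_comp_add_mul
    (fun x => (x - u) ^ a * (v - x) ^ b * f x) hd u (a := 0) (b := 1)
  simp only [mul_zero, add_zero, mul_one, add_sub_cancel] at h1
  have h2 : (v - u) ^ (a + b) * betaAvg a b f u v =
      (v - u)⁻¹ • ∫ x in u..v, (x - u) ^ a * (v - x) ^ b * f x := by
    rw [← h1, betaAvg, ← intervalIntegral.integral_const_mul]
    refine intervalIntegral.integral_congr fun x _ => ?_
    rw [show u + (v - u) * x - u = (v - u) * x by ring,
      show v - (u + (v - u) * x) = (v - u) * (1 - x) by ring, mul_pow, mul_pow, pow_add]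
    ring
  rw [pow_succ', mul_assoc, h2, smul_eq_mul, mul_inv_cancel_left₀ hd]

lemma segment_mem {τ u v x : ℝ} (hu : τ < u) (hv : τ < v) (hx : x ∈ Icc (0 : ℝ) 1) :
    τ < u + (v - u) * x := by
  have h := (convex_Ioi τ).add_smul_sub_mem hu hv hx
  simpa [mul_comm] using h

lemma continuousOn_beta_integrand (a b : ℕ) {τ : ℝ} {f : ℝ → ℝ} (hf : ContinuousOn f (Ioi τ))
    {u v : ℝ} (hu : τ < u) (hv : τ < v) :
    ContinuousOn (fun x => x ^ a * (1 - x) ^ b * f (u + (v - u) * x)) (Icc 0 1) := by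
  refine ContinuousOn.mul (by fun_prop) (hf.comp (by fun_prop) fun x hx => segment_mem hu hv hx)

/-- Differentiation under the integral: moving `v` moves the point `u + (v - u) * x` at speed `x`,
and this factor raises the first exponent. -/
lemma hasDerivAt_betaAvg_right (a b : ℕ) {τ : ℝ} {f f' : ℝ → ℝ}
    (hf : ∀ x, τ < x → HasDerivAt f (f' x) x) (hf' : ContinuousOn f' (Ioi τ)) {u v : ℝ}
    (hu : τ < u) (hv : τ < v) :
    HasDerivAt (fun v => betaAvg a b f u v) (betaAvg (a + 1) b f' u v) v := by
  have hfc : ContinuousOn f (Ioi τ) := fun x hx => (hf x hx).continuousAt.continuousWithinAt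
  -- For right ends near `v` all segments stay in one compact subset of `(τ, ∞)`, which provides a
  -- uniform bound on `f'` although `f'` may blow up at `τ`.
  have hlo : τ < min u ((τ + v) / 2) := lt_min hu (by linarith)
  have hK : Icc (min u ((τ + v) / 2)) (max u (v + 1)) ⊆ Ioi τ := fun x hx => hlo.trans_le hx.1
  obtain ⟨C, hC⟩ := isCompact_Icc.exists_bound_of_continuousOn (hf'.mono hK)
  have hs : Ioo ((τ + v) / 2) (v + 1) ∈ 𝓝 v := Ioo_mem_nhds (by linarith) (by linarith)
  have hsτ : ∀ y ∈ Ioo ((τ + v) / 2) (v + 1), τ < y := fun y hy => by linarith [hy.1]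
  have huI : uIoc (0 : ℝ) 1 ⊆ Icc 0 1 := by
    rw [uIoc_of_le zero_le_one]; exact Ioc_subset_Icc_self
  have hint : ∀ (c d : ℕ) {g : ℝ → ℝ}, ContinuousOn g (Ioi τ) → ∀ y, τ < y →
      IntervalIntegrable (fun x => x ^ c * (1 - x) ^ d * g (u + (y - u) * x)) volume 0 1 := by
    intro c d g hg y hy
    refine ContinuousOn.intervalIntegrable ?_
    rw [uIcc_of_le zero_le_one]
    exact continuousOn_beta_integrand c d hg hu hy
  refine (intervalIntegral.hasDerivAt_integral_of_dominated_loc_of_deriv_le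
    (F := fun y x => x ^ a * (1 - x) ^ b * f (u + (y - u) * x))
    (F' := fun y x => x ^ (a + 1) * (1 - x) ^ b * f' (u + (y - u) * x))
    (bound := fun _ => C) hs ?_ (hint a b hfc v hv) ?_ ?_ ?_ ?_).2
  · filter_upwards [hs] with y hy
    exact (intervalIntegrable_iff.1 (hint a b hfc y (hsτ y hy))).aestronglyMeasurable
  · exact (intervalIntegrable_iff.1 (hint (a + 1) b hf' v hv)).aestronglyMeasurable
  · refine ae_of_all _ fun x hx y hy => ?_
    obtain ⟨h0, h1⟩ := huI hx
    have hmem : u + (y - u) * x ∈ Icc (min u ((τ + v) / 2)) (max u (v + 1)) := by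
      have := (convex_Icc (min u ((τ + v) / 2)) (max u (v + 1))).add_smul_sub_mem
        (show u ∈ _ from ⟨min_le_left _ _, le_max_left _ _⟩)
        (show y ∈ _ from ⟨(min_le_right _ _).trans hy.1.le, hy.2.le.trans (le_max_right _ _)⟩)
        (huI hx)
      simpa [mul_comm] using this
    have hb := hC _ hmem
    rw [norm_mul, norm_mul, Real.norm_of_nonneg (pow_nonneg h0 _),
      Real.norm_of_nonneg (pow_nonneg (sub_nonneg.2 h1) _)]
    have hw1 : x ^ (a + 1) ≤ 1 := pow_le_one₀ h0 h1
    have hw2 : (1 - x) ^ b ≤ 1 := pow_le_one₀ (sub_nonneg.2 h1) (by linarith)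
    have hw : x ^ (a + 1) * (1 - x) ^ b ≤ 1 :=
      mul_le_one₀ hw1 (pow_nonneg (sub_nonneg.2 h1) _) hw2
    exact (mul_le_of_le_one_left (norm_nonneg _) hw).trans hb
  · exact intervalIntegrable_const
  · refine ae_of_all _ fun x hx y hy => ?_
    have h1 : HasDerivAt (fun y : ℝ => u + (y - u) * x) x y := by
      simpa using (((hasDerivAt_id y).sub_const u).mul_const x).const_add u
    have h2 := ((hf _ (segment_mem hu (hsτ y hy) (huI hx))).comp y h1).const_mul
      (x ^ a * (1 - x) ^ b)
    refine h2.congr_deriv ?_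
    ring

lemma hasDerivAt_betaAvg_left (a b : ℕ) {τ : ℝ} {f f' : ℝ → ℝ}
    (hf : ∀ x, τ < x → HasDerivAt f (f' x) x) (hf' : ContinuousOn f' (Ioi τ)) {u v : ℝ}
    (hu : τ < u) (hv : τ < v) :
    HasDerivAt (fun u => betaAvg a b f u v) (betaAvg a (b + 1) f' u v) u := by
  have h := hasDerivAt_betaAvg_right b a hf hf' hv hu
  rw [betaAvg_swap] at h
  exact h.congr_of_eventuallyEq (Eventually.of_forall fun y => betaAvg_swap a b f y v)

section smooth

variable {τ : ℝ} {n : ℕ} {h : ℝ → ℝ} (hh : ContDiffOn ℝ n h (Ioi τ))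
include hh

lemma ContDiffOn.continuousOn_iteratedDeriv_Ioi {m : ℕ} (hm : m ≤ n) :
    ContinuousOn (iteratedDeriv m h) (Ioi τ) :=
  (hh.continuousOn_iteratedDerivWithin (by exact_mod_cast hm) (uniqueDiffOn_Ioi τ)).congr
    fun x hx => (iteratedDerivWithin_of_isOpen isOpen_Ioi hx).symm

lemma ContDiffOn.hasDerivAt_iteratedDeriv_Ioi {m : ℕ} (hm : m < n) {x : ℝ} (hx : τ < x) :
    HasDerivAt (iteratedDeriv m h) (iteratedDeriv (m + 1) h x) x := by
  have h1 : DifferentiableOn ℝ (iteratedDeriv m h) (Ioi τ) :=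
    (hh.differentiableOn_iteratedDerivWithin (by exact_mod_cast hm) (uniqueDiffOn_Ioi τ)).congr
      fun x hx => (iteratedDerivWithin_of_isOpen isOpen_Ioi hx).symm
  rw [iteratedDeriv_succ]
  exact (h1.differentiableAt (Ioi_mem_nhds hx)).hasDerivAt

/-- The difference quotient is the mean of `h'` over the segment; each derivative in `v` passes
under the integral. The formula needs `u ≠ v`, which persists near `v` and so can be differentiated
again. -/
lemma iteratedDeriv_quot_eq_betaAvg {j : ℕ} (hj : j + 1 ≤ n) {u v : ℝ} (hu : τ < u) (hv : τ < v)
    (huv : u ≠ v) :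
    iteratedDeriv j (fun y => (h y - h u) / (y - u)) v =
      betaAvg j 0 (iteratedDeriv (j + 1) h) u v := by
  induction j generalizing v with
  | zero =>
    have hd : v - u ≠ 0 := sub_ne_zero.2 huv.symm
    have h1 := pow_mul_betaAvg 0 0 (iteratedDeriv 1 h) huv
    have hsub : uIcc u v ⊆ Ioi τ := fun x hx => (lt_min hu hv).trans_le hx.1
    simp only [pow_zero, one_mul, zero_add, pow_one] at h1
    rw [intervalIntegral.integral_eq_sub_of_hasDerivAt (f := h) (fun x hx => by
        simpa using hh.hasDerivAt_iteratedDeriv_Ioi (m := 0) (by omega) (hsub hx))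
      ((hh.continuousOn_iteratedDeriv_Ioi (by omega)).mono hsub).intervalIntegrable] at h1
    rw [iteratedDeriv_zero, ← h1, mul_div_cancel_left₀ _ hd]
  | succ j ih =>
    rw [iteratedDeriv_succ]
    have hev : iteratedDeriv j (fun y => (h y - h u) / (y - u)) =ᶠ[𝓝 v]
        fun v => betaAvg j 0 (iteratedDeriv (j + 1) h) u v := by
      filter_upwards [Ioi_mem_nhds hv, isOpen_ne.mem_nhds huv.symm] with y hy hyu
      exact ih (by omega) hy (Ne.symm hyu)
    rw [hev.deriv_eq]
    exact (hasDerivAt_betaAvg_right j 0 (fun x hx => hh.hasDerivAt_iteratedDeriv_Ioi (by omega) hx)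
      (hh.continuousOn_iteratedDeriv_Ioi hj) hu hv).deriv

lemma quotDeriv_eq_betaAvg {i j : ℕ} (hij : i + j + 1 ≤ n) {u v : ℝ} (hu : τ < u) (hv : τ < v)
    (huv : u ≠ v) :
    quotDeriv h i j u v = betaAvg j i (iteratedDeriv (i + j + 1) h) u v := by
  induction i generalizing u with
  | zero =>
    rw [quotDeriv, iteratedDeriv_zero, iteratedDeriv_quot_eq_betaAvg hh (by omega) hu hv huv,
      zero_add]
  | succ i ih =>
    rw [quotDeriv, iteratedDeriv_succ]
    have hev : iteratedDeriv i (fun x => iteratedDeriv j (fun y => (h y - h x) / (y - x)) v) =ᶠ[𝓝 u]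
        fun u => betaAvg j i (iteratedDeriv (i + j + 1) h) u v := by
      filter_upwards [Ioi_mem_nhds hu, isOpen_ne.mem_nhds huv] with y hy hyu
      exact ih (by omega) hy hyu
    rw [hev.deriv_eq, show i + 1 + j + 1 = i + j + 1 + 1 by ring]
    exact (hasDerivAt_betaAvg_left j i (fun x hx => hh.hasDerivAt_iteratedDeriv_Ioi (by omega) hx)
      (hh.continuousOn_iteratedDeriv_Ioi (by omega)) hu hv).deriv

/-- This is the order at which the smoothness of `h` may be exhausted: the integrand need not be
differentiable, so the last derivative stays outside the integral. The fundamental theorem of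
calculus evaluates it later. -/
lemma quotDeriv_succ_right_eq_deriv_betaAvg {j : ℕ} (hj : j + 1 ≤ n) {u v : ℝ} (hu : τ < u)
    (hv : τ < v) (huv : u ≠ v) :
    quotDeriv h 0 (j + 1) u v = deriv (fun v => betaAvg j 0 (iteratedDeriv (j + 1) h) u v) v := by
  rw [quotDeriv, iteratedDeriv_zero, iteratedDeriv_succ]
  refine EventuallyEq.deriv_eq ?_
  filter_upwards [Ioi_mem_nhds hv, isOpen_ne.mem_nhds huv.symm] with y hy hyu
  exact iteratedDeriv_quot_eq_betaAvg hh hj hu hy (Ne.symm hyu)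

lemma quotDeriv_succ_left_eq_deriv_betaAvg {i j : ℕ} (hij : i + j + 1 ≤ n) {u v : ℝ} (hu : τ < u)
    (hv : τ < v) (huv : u ≠ v) :
    quotDeriv h (i + 1) j u v =
      deriv (fun u => betaAvg j i (iteratedDeriv (i + j + 1) h) u v) u := by
  rw [quotDeriv, iteratedDeriv_succ]
  refine EventuallyEq.deriv_eq ?_
  filter_upwards [Ioi_mem_nhds hu, isOpen_ne.mem_nhds huv] with y hy hyu
  exact quotDeriv_eq_betaAvg hh hij hy hv hyu

end smooth

/-! ### Endpoint derivatives of averages of rough integrands -/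

lemma hasDerivAt_integral_sub_pow_mul (a : ℕ) {g : ℝ → ℝ} {c p z : ℝ} (hcp : c < p) (hpz : p < z)
    (hg : IntervalIntegrable g volume c z) :
    HasDerivAt (fun q => ∫ x in q..z, (x - q) ^ (a + 1) * g x)
      (-((a + 1 : ℝ) * ∫ x in p..z, (x - p) ^ a * g x)) p := by
  have hcz : c < z := hcp.trans hpz
  have hgI : IntegrableOn g (Ioc c z) := (intervalIntegrable_iff_integrableOn_Ioc_of_le hcz.le).1 hg
  have hs : Ioo c z ∈ 𝓝 p := Ioo_mem_nhds hcp hpz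
  -- The positive part moves the variable endpoint into the integrand, over the fixed interval from
  -- `c` to `z`. The result is Lipschitz in `q`, with constant an integrable multiple of `|g x|`.
  set F : ℝ → ℝ → ℝ := fun q x => max (x - q) 0 ^ (a + 1) * g x with hF
  set F' : ℝ → ℝ := fun x => (Ioi p).indicator (fun x => -((a + 1 : ℝ) * ((x - p) ^ a * g x))) x
    with hF'
  have hFint : ∀ q, IntervalIntegrable (F q) volume c z := fun q =>
    hg.continuousOn_mul (by fun_prop)
  have hF'int : IntervalIntegrable F' volume c z := by
    rw [intervalIntegrable_iff_integrableOn_Ioc_of_le hcz.le]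
    refine IntegrableOn.indicator ?_ measurableSet_Ioi
    have := (hg.continuousOn_mul (g := fun x => -((a + 1 : ℝ) * (x - p) ^ a)) (by fun_prop))
    rw [intervalIntegrable_iff_integrableOn_Ioc_of_le hcz.le] at this
    refine this.congr_fun (fun x _ => ?_) measurableSet_Ioc
    simp only
    ring
  have key := (intervalIntegral.hasDerivAt_integral_of_dominated_loc_of_lip (μ := volume)
    (F := F) (F' := F') (x₀ := p) (a := c) (b := z)
    (bound := fun x => (a + 1 : ℝ) * (z - c) ^ a * |g x|) hs
    (Eventually.of_forall fun q => (intervalIntegrable_iff.1 (hFint q)).aestronglyMeasurable)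
    (hFint p) (intervalIntegrable_iff.1 hF'int).aestronglyMeasurable ?_ ?_ ?_).2
  · have e1 : ∀ q ∈ Ioo c z, ∫ x in q..z, (x - q) ^ (a + 1) * g x = ∫ x in c..z, F q x := by
      intro q hq
      have hq1 : IntervalIntegrable (F q) volume c q :=
        (hFint q).mono_set (by rw [uIcc_of_le hq.1.le, uIcc_of_le hcz.le]; exact Icc_subset_Icc_right hq.2.le)
      have hq2 : IntervalIntegrable (F q) volume q z :=
        (hFint q).mono_set (by rw [uIcc_of_le hq.2.le, uIcc_of_le hcz.le]; exact Icc_subset_Icc_left hq.1.le)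
      rw [← intervalIntegral.integral_add_adjacent_intervals hq1 hq2]
      have z1 : ∫ x in c..q, F q x = 0 := by
        refine (intervalIntegral.integral_congr (g := fun _ => 0) fun x hx => ?_).trans (by simp)
        rw [uIcc_of_le hq.1.le] at hx
        simp [hF, max_eq_right (sub_nonpos.2 hx.2)]
      rw [z1, zero_add]
      refine intervalIntegral.integral_congr fun x hx => ?_
      rw [uIcc_of_le hq.2.le] at hx
      simp [hF, max_eq_left (sub_nonneg.2 hx.1)]
    have e2 : ∫ x in c..z, F' x = -((a + 1 : ℝ) * ∫ x in p..z, (x - p) ^ a * g x) := by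
      rw [← intervalIntegral.integral_const_mul, ← intervalIntegral.integral_neg,
        intervalIntegral.integral_of_le hcz.le, intervalIntegral.integral_of_le hpz.le,
        setIntegral_indicator measurableSet_Ioi, Ioc_inter_Ioi, max_eq_right hcp.le]
    rw [e2] at key
    refine key.congr_of_eventuallyEq ?_
    filter_upwards [hs] with q hq using e1 q hq
  · refine ae_of_all _ fun x hx => ?_
    rw [uIoc_of_le hcz.le] at hx
    rw [lipschitzOnWith_iff_dist_le_mul]
    intro q hq q' hq'
    have hb : ∀ q ∈ Ioo c z, |max (x - q) 0| ≤ z - c := by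
      intro q hq
      rw [abs_of_nonneg (le_max_right _ _)]
      exact max_le (by linarith [hx.2, hq.1]) (by linarith)
    have h1 := abs_pow_sub_pow_le (max (x - q) 0) (max (x - q') 0) (a + 1)
    have h2 : |max (x - q) 0 - max (x - q') 0| ≤ |q - q'| := by
      refine (abs_max_sub_max_le_abs _ _ _).trans ?_
      rw [sub_sub_sub_cancel_left, abs_sub_comm]
    have h3 : max |max (x - q) 0| |max (x - q') 0| ^ a ≤ (z - c) ^ a :=
      pow_le_pow_left₀ (le_max_of_le_left (abs_nonneg _)) (max_le (hb q hq) (hb q' hq')) a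
    have hzc : 0 ≤ z - c := by linarith
    rw [Real.dist_eq, Real.dist_eq, hF]
    simp only [Real.coe_nnabs]
    rw [← sub_mul, abs_mul, abs_of_nonneg (by positivity : 0 ≤ (a + 1 : ℝ) * (z - c) ^ a * |g x|)]
    calc _ ≤ (|max (x - q) 0 - max (x - q') 0| * ((a + 1 : ℕ) : ℝ) *
          max |max (x - q) 0| |max (x - q') 0| ^ (a + 1 - 1)) * |g x| := by gcongr
      _ ≤ (|q - q'| * ((a + 1 : ℕ) : ℝ) * (z - c) ^ a) * |g x| := by
          rw [Nat.add_sub_cancel]; gcongr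
      _ = _ := by push_cast; ring
  · exact (hg.abs).const_mul _
  · have hne : ∀ᵐ x : ℝ, x ≠ p := by simp [ae_iff, measure_singleton]
    filter_upwards [hne] with x hx _
    rcases lt_or_gt_of_ne hx with h | h
    · have : F' x = 0 := indicator_of_notMem (by simpa using h.le) _
      rw [this]
      refine (hasDerivAt_const p (0 : ℝ)).congr_of_eventuallyEq ?_
      filter_upwards [lt_mem_nhds h] with q hq
      simp [hF, max_eq_right (sub_nonpos.2 hq.le)]
    · have : F' x = -((a + 1 : ℝ) * ((x - p) ^ a * g x)) := indicator_of_mem (show x ∈ Ioi p from h) _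
      rw [this]
      have h1 : HasDerivAt (fun q => (x - q) ^ (a + 1) * g x)
          (-((a + 1 : ℝ) * ((x - p) ^ a * g x))) p := by
        have := (((hasDerivAt_id p).const_sub x).pow (a + 1)).mul_const (g x)
        refine this.congr_deriv ?_
        simp only [id, Nat.add_sub_cancel]
        push_cast
        ring
      refine h1.congr_of_eventuallyEq ?_
      filter_upwards [gt_mem_nhds h] with q hq
      simp [hF, max_eq_left (sub_nonneg.2 hq.le)]

lemma betaAvg_eq_div (a b : ℕ) (f : ℝ → ℝ) {u v : ℝ} (h : u ≠ v) :
    betaAvg a b f u v =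
      (∫ x in u..v, (x - u) ^ a * (v - x) ^ b * f x) / (v - u) ^ (a + b + 1) := by
  rw [← pow_mul_betaAvg a b f h, mul_div_cancel_left₀ _ (pow_ne_zero _ (sub_ne_zero.2 h.symm))]

/-- The derivative of `betaAvg` in its left argument needs no regularity of the integrand. -/
lemma hasDerivAt_betaAvg_left_of_integrable (a b : ℕ) {g : ℝ → ℝ} {c p z : ℝ} (hcp : c < p)
    (hpz : p < z) (hg : IntervalIntegrable g volume c z) :
    HasDerivAt (fun p => betaAvg (a + 1) b g p z)
      (((a + b + 2 : ℝ) * betaAvg (a + 1) b g p z - (a + 1) * betaAvg a b g p z) / (z - p)) p := by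
  have hd : z - p ≠ 0 := by linarith
  have hgb : IntervalIntegrable (fun x => (z - x) ^ b * g x) volume c z :=
    hg.continuousOn_mul (by fun_prop)
  have h1 := hasDerivAt_integral_sub_pow_mul a hcp hpz hgb
  have h2 : HasDerivAt (fun q => (z - q) ^ (a + 1 + b + 1))
      (-((a + 1 + b + 1 : ℕ) * (z - p) ^ (a + 1 + b))) p := by
    have := ((hasDerivAt_id p).const_sub z).pow (a + 1 + b + 1)
    refine this.congr_deriv ?_
    simp only [id, Nat.add_sub_cancel]
    ring
  have h3 := h1.div h2 (pow_ne_zero _ hd)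
  have e0 := pow_mul_betaAvg a b g hpz.ne
  have e1 := pow_mul_betaAvg (a + 1) b g hpz.ne
  simp only [mul_assoc] at e0 e1
  rw [← e0, ← e1] at h3
  refine (h3.congr_deriv ?_).congr_of_eventuallyEq ?_
  · push_cast
    rw [show a + 1 + b + 1 = a + b + 2 by ring, show a + 1 + b = a + b + 1 by ring]
    field_simp
    ring
  · filter_upwards [gt_mem_nhds hpz] with q hq
    rw [betaAvg_eq_div _ _ _ hq.ne]
    simp only [mul_assoc, Pi.div_apply]

/-- With exponent `b = 0` the weight does not vanish at the right end, so mere integrability gives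
continuity there but not a derivative. -/
lemma continuousAt_betaAvg_right_of_integrable (a : ℕ) {g : ℝ → ℝ} {p z d : ℝ} (hpz : p < z)
    (hzd : z < d) (hg : IntervalIntegrable g volume p d) :
    ContinuousAt (fun z => betaAvg a 0 g p z) z := by
  have h1 : ContinuousOn (fun z => ∫ x in p..z, (x - p) ^ a * g x) (uIcc p d) :=
    intervalIntegral.continuousOn_primitive_interval' (hg.continuousOn_mul (by fun_prop))
      left_mem_uIcc
  rw [uIcc_of_le (hpz.trans hzd).le] at h1
  have h2 := (h1.continuousAt (Icc_mem_nhds hpz hzd)).div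
    (by fun_prop : ContinuousAt (fun z => (z - p) ^ (a + 0 + 1)) z)
    (pow_ne_zero _ (sub_ne_zero.2 hpz.ne'))
  refine h2.congr ?_
  filter_upwards [lt_mem_nhds hpz] with y hy
  rw [betaAvg_eq_div _ _ _ hy.ne]
  simp

lemma hasDerivAt_betaAvg_right_of_continuousOn (a : ℕ) {g : ℝ → ℝ} {m p z : ℝ} (hmp : m < p)
    (hpz : p < z) (hg : ContinuousOn g (Ioi m)) :
    HasDerivAt (fun z => betaAvg a 0 g p z)
      ((g z - (a + 1) * betaAvg a 0 g p z) / (z - p)) z := by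
  have hd : z - p ≠ 0 := by linarith
  have hgc : ContinuousOn (fun x => (x - p) ^ a * g x) (Ioi m) := by fun_prop
  have hz : m < z := hmp.trans hpz
  have hsub : uIcc p z ⊆ Ioi m := fun x hx => (lt_min hmp hz).trans_le hx.1
  have h1 : HasDerivAt (fun z => ∫ x in p..z, (x - p) ^ a * g x) ((z - p) ^ a * g z) z :=
    intervalIntegral.integral_hasDerivAt_right (hgc.mono hsub).intervalIntegrable
      (hgc.stronglyMeasurableAtFilter isOpen_Ioi z hz) (hgc.continuousAt (Ioi_mem_nhds hz))
  have h2 : HasDerivAt (fun q => (q - p) ^ (a + 0 + 1)) ((a + 0 + 1 : ℕ) * (z - p) ^ (a + 0)) z := by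
    have := ((hasDerivAt_id z).sub_const p).pow (a + 0 + 1)
    refine this.congr_deriv ?_
    simp only [id, Nat.add_sub_cancel]
    ring
  have h3 := h1.div h2 (pow_ne_zero _ hd)
  have e1 := pow_mul_betaAvg a 0 g hpz.ne
  simp only [pow_zero, mul_one] at e1
  rw [← e1] at h3
  refine (h3.congr_deriv ?_).congr_of_eventuallyEq ?_
  · simp only [add_zero]
    push_cast
    field_simp
    ring
  · filter_upwards [lt_mem_nhds hpz] with q hq
    rw [betaAvg_eq_div _ _ _ hq.ne]
    simp only [pow_zero, mul_one, Pi.div_apply]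

/-! ### Nonvanishing near the left end, and regularity of the reparametrisation -/

lemma NonzeroRightLimit.exists_le_abs {ψ : ℝ → ℝ} {τ : ℝ} (h : NonzeroRightLimit ψ τ) :
    ∃ ε > 0, ∀ᶠ u in 𝓝[>] τ, ε ≤ |ψ u| := by
  obtain ⟨L, hL0, hL⟩ := h
  rcases lt_or_gt_of_ne hL0 with h | h
  · obtain ⟨x, hx, hx0⟩ := EReal.lt_iff_exists_real_btwn.1 h
    have hx0' : x < 0 := by exact_mod_cast hx0
    refine ⟨-x, by linarith, ?_⟩
    filter_upwards [hL.eventually (gt_mem_nhds hx)] with u hu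
    have : ψ u < x := by exact_mod_cast hu
    rw [abs_of_neg (by linarith)]
    linarith
  · obtain ⟨x, hx0, hx⟩ := EReal.lt_iff_exists_real_btwn.1 h
    have hx0' : 0 < x := by exact_mod_cast hx0
    refine ⟨x, hx0', ?_⟩
    filter_upwards [hL.eventually (lt_mem_nhds hx)] with u hu
    have : x < ψ u := by exact_mod_cast hu
    rw [abs_of_pos (by linarith)]
    linarith

/-- By compactness it suffices to identify cluster points of `θ` at `z`: any such `y` satisfies `g y
= g (θ z)`, hence `y = θ z`. -/
lemma continuousAt_of_comp_injOn {θ g : ℝ → ℝ} {K : Set ℝ} (hK : IsCompact K)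
    (hg : ∀ y ∈ K, ContinuousAt g y) (hinj : InjOn g K) {z : ℝ} (hθ : ∀ᶠ y in 𝓝 z, θ y ∈ K)
    (hc : ContinuousAt (fun y => g (θ y)) z) : ContinuousAt θ z := by
  refine hK.tendsto_nhds_of_unique_mapClusterPt hθ fun y hy hcl => ?_
  refine hinj hy hθ.self_of_nhds ?_
  have h1 : MapClusterPt (g y) (𝓝 z) (fun y => g (θ y)) := hcl.continuousAt_comp (hg y hy)
  exact eq_of_nhds_neBot (ClusterPt.mono h1 hc)

/-- The difference quotient of `θ` is that of `g ∘ θ` divided by the slope of `g` between `θ z` and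
`θ y`; continuity of `θ` sends this slope to `g' ≠ 0`. -/
lemma hasDerivAt_of_comp {θ g : ℝ → ℝ} {z g' b' : ℝ} (hθ : ContinuousAt θ z)
    (hg : HasDerivAt g g' (θ z)) (hg' : g' ≠ 0) (hb : HasDerivAt (fun y => g (θ y)) b' z) :
    HasDerivAt θ (b' / g') z := by
  rw [hasDerivAt_iff_tendsto_slope] at hb ⊢
  have h1 : Tendsto (fun y => dslope g (θ z) (θ y)) (𝓝 z) (𝓝 g') := by
    have := (continuousAt_dslope_same.2 hg.differentiableAt).tendsto.comp hθ
    rwa [dslope_same, hg.deriv] at this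
  have h2 := h1.mono_left (nhdsWithin_le_nhds (s := {z}ᶜ))
  refine (hb.div h2 hg').congr' ?_
  filter_upwards [h2.eventually_ne hg'] with y hy
  have h3 := sub_smul_dslope g (θ z) (θ y)
  simp only [smul_eq_mul] at h3
  rw [Pi.div_apply, div_eq_iff hy, slope_def_field, slope_def_field, ← h3]
  ring

lemma injOn_of_hasDerivAt_ne_zero {g g' : ℝ → ℝ} {K : Set ℝ} (hK : K.OrdConnected)
    (hg : ∀ y ∈ K, HasDerivAt g (g' y) y) (h0 : ∀ y ∈ K, g' y ≠ 0) : InjOn g K := by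
  have key : ∀ x ∈ K, ∀ y ∈ K, x < y → g x ≠ g y := by
    intro x hx y hy hxy he
    obtain ⟨w, hw, hw0⟩ := exists_hasDerivAt_eq_zero hxy
      (fun v hv => (hg v (hK.out hx hy hv)).continuousAt.continuousWithinAt) he
      (fun v hv => hg v (hK.out hx hy (Ioo_subset_Icc_self hv)))
    exact h0 w (hK.out hx hy (Ioo_subset_Icc_self hw)) hw0
  intro x hx y hy he
  rcases lt_trichotomy x y with h | h | h
  exacts [absurd he (key x hx y hy h), h, absurd he.symm (key y hy x hx h)]

/-- The condition concerns one `v₀` and `u → τ`; here it is made uniform in `v` near `v₀`. After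
multiplication by `(v - u) ^ (a + 1)`, the change from `v₀` to `v` involves `f` only between `v₀`
and `v`, so it is small whatever `f` does near `τ`, while the value at `v₀` is bounded away from
`0`. -/
lemma eventually_deriv_betaAvg_ne_zero (a : ℕ) {τ : ℝ} {f : ℝ → ℝ} (hf : ContinuousOn f (Ioi τ))
    {v₀ : ℝ} (hv₀ : τ < v₀)
    (hne : NonzeroRightLimit (fun u => deriv (fun v => betaAvg a 0 f u v) v₀) τ) :
    ∀ᶠ p : ℝ × ℝ in 𝓝 (τ, v₀), τ < p.1 →
      f p.2 - (a + 1) * betaAvg a 0 f p.1 p.2 ≠ 0 := by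
  obtain ⟨ε, hε, hev⟩ := hne.exists_le_abs
  obtain ⟨m, hm1, hm2⟩ := exists_between hv₀
  set J : ℝ × ℝ → ℝ := fun p => ∫ x in v₀..p.2, (x - p.1) ^ a * f x with hJ
  set D : ℝ × ℝ → ℝ := fun p =>
    (f p.2 * (p.2 - p.1) ^ (a + 1) - f v₀ * (v₀ - p.1) ^ (a + 1)) - (a + 1) * J p with hD
  set g : ℝ × ℝ → ℝ := fun p =>
    (f p.2 - (a + 1) * betaAvg a 0 f p.1 p.2) * (p.2 - p.1) ^ (a + 1) with hg
  have hgD : ∀ p : ℝ × ℝ, τ < p.1 → p.1 < m → m < p.2 → g p = g (p.1, v₀) + D p := by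
    intro p h1 h2 h3
    have hint : ∀ x y, m < x → m < y →
        IntervalIntegrable (fun x => (x - p.1) ^ a * f x) volume p.1 y := by
      intro x y hx hy
      refine ContinuousOn.intervalIntegrable ?_
      have : ContinuousOn (fun x => (x - p.1) ^ a * f x) (Ioi τ) := by fun_prop
      exact this.mono fun w hw => (lt_min h1 (hm1.trans hy)).trans_le hw.1
    have e1 := pow_mul_betaAvg a 0 f (h2.trans h3).ne
    have e2 := pow_mul_betaAvg a 0 f (h2.trans hm2).ne
    have e3 := intervalIntegral.integral_add_adjacent_intervals
      (hint v₀ v₀ hm2 hm2) ((hint v₀ v₀ hm2 hm2).symm.trans (hint p.2 p.2 h3 h3))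
    simp only [pow_zero, mul_one, add_zero] at e1 e2
    simp only [hg, hD, hJ]
    linear_combination (-(a + 1 : ℝ)) * e1 + (a + 1 : ℝ) * e2 + (a + 1 : ℝ) * e3
  have hDlim : Tendsto D (𝓝 (τ, v₀)) (𝓝 0) := by
    have hfc : ContinuousAt f v₀ := hf.continuousAt (Ioi_mem_nhds hv₀)
    have hJlim : Tendsto J (𝓝 (τ, v₀)) (𝓝 0) := by
      have hcpt : IsCompact (Icc (τ - 1) m ×ˢ Icc m (v₀ + 1)) := isCompact_Icc.prod isCompact_Icc
      obtain ⟨C, hC⟩ := hcpt.exists_bound_of_continuousOn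
        (f := fun q : ℝ × ℝ => (q.2 - q.1) ^ a * f q.2) (by
          refine ContinuousOn.mul (by fun_prop) (hf.comp continuousOn_snd fun q hq => ?_)
          exact hm1.trans_le hq.2.1)
      have hlim : Tendsto (fun p : ℝ × ℝ => C * |p.2 - v₀|) (𝓝 (τ, v₀)) (𝓝 0) := by
        have : ContinuousAt (fun p : ℝ × ℝ => C * |p.2 - v₀|) (τ, v₀) := by fun_prop
        simpa [ContinuousAt] using this
      refine squeeze_zero_norm' ?_ hlim
      have hn : Ioo (τ - 1) m ×ˢ Ioo m (v₀ + 1) ∈ 𝓝 (τ, v₀) :=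
        prod_mem_nhds (Ioo_mem_nhds (by linarith) hm1) (Ioo_mem_nhds hm2 (by linarith))
      filter_upwards [hn] with p hp
      refine intervalIntegral.norm_integral_le_of_norm_le_const fun x hx => ?_
      refine hC (p.1, x) ⟨Ioo_subset_Icc_self hp.1, ?_, ?_⟩
      · exact (lt_min hm2 hp.2.1).le.trans hx.1.le
      · exact hx.2.trans (max_le (by linarith) hp.2.2.le)
    have h1 : ContinuousAt (fun p : ℝ × ℝ =>
        f p.2 * (p.2 - p.1) ^ (a + 1) - f v₀ * (v₀ - p.1) ^ (a + 1)) (τ, v₀) := by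
      have : ContinuousAt (fun p : ℝ × ℝ => f p.2) (τ, v₀) :=
        ContinuousAt.comp (f := fun p : ℝ × ℝ => p.2) (x := (τ, v₀)) hfc continuousAt_snd
      fun_prop
    have h2 := h1.tendsto.sub (hJlim.const_mul (a + 1 : ℝ))
    simpa using h2
  have hE : ∀ᶠ p : ℝ × ℝ in 𝓝 (τ, v₀), τ < p.1 →
      ε * ((v₀ - τ) / 2) ^ (a + 2) ≤ |g (p.1, v₀)| := by
    have h1 : ∀ᶠ u in 𝓝 τ, τ < u → ε ≤ |deriv (fun v => betaAvg a 0 f u v) v₀| := by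
      simpa [eventually_nhdsWithin_iff] using hev
    have h2 : ∀ᶠ u in 𝓝 τ, u < (τ + v₀) / 2 := gt_mem_nhds (by linarith)
    filter_upwards [continuousAt_fst.eventually (h1.and h2)] with p ⟨hp1, hp2⟩ hp
    have hlt : p.1 < v₀ := by linarith
    have hd : 0 < v₀ - p.1 := by linarith
    have h3 := hp1 hp
    rw [(hasDerivAt_betaAvg_right_of_continuousOn a hp hlt hf).deriv] at h3
    -- The quotient is the derivative bounded below by `ε`; the remaining power is at least `((v₀ -
    -- τ) / 2) ^ (a + 2)` because `p.1` lies below the midpoint of `τ` and `v₀`.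
    have h4 : g (p.1, v₀) = (f v₀ - (a + 1) * betaAvg a 0 f p.1 v₀) / (v₀ - p.1) *
        (v₀ - p.1) ^ (a + 2) := by
      simp only [hg]
      field_simp
      ring
    rw [h4, abs_mul, abs_of_pos (pow_pos hd _)]
    have h5 : (v₀ - τ) / 2 ≤ v₀ - p.1 := by linarith
    have h6 : 0 ≤ (v₀ - τ) / 2 := by linarith
    gcongr
  have hε' : 0 < ε * ((v₀ - τ) / 2) ^ (a + 2) := by
    have : 0 < (v₀ - τ) / 2 := by linarith
    positivity
  have hDs : ∀ᶠ p in 𝓝 (τ, v₀), |D p| < ε * ((v₀ - τ) / 2) ^ (a + 2) := by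
    have := hDlim.abs
    rw [abs_zero] at this
    exact this.eventually (gt_mem_nhds hε')
  have hn : Iio m ×ˢ Ioi m ∈ 𝓝 (τ, v₀) := prod_mem_nhds (Iio_mem_nhds hm1) (Ioi_mem_nhds hm2)
  filter_upwards [hE, hDs, hn] with p h1 h2 h3 hp h0
  have h4 := hgD p hp h3.1 h3.2
  have h5 : g p = 0 := by simp only [hg, h0, zero_mul]
  have h6 := h1 hp
  rw [show g (p.1, v₀) = -D p by linarith, abs_neg] at h6
  linarith

lemma measurable_indicator_of_continuousOn {τ : ℝ} {f : ℝ → ℝ} (hf : ContinuousOn f (Ioi τ)) :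
    Measurable ((Ioi τ).indicator f) := by
  classical
  rw [← piecewise_eq_indicator]
  exact hf.measurable_piecewise continuousOn_const measurableSet_Ioi

/-! ### The reparametrisation must be affine -/

section

variable {τ : ℝ} {f θ : ℝ → ℝ} (hf : ContinuousOn f (Ioi τ)) (hθm : StrictMonoOn θ (Ioi 0))
  (hθτ : ∀ z, 0 < z → τ < θ z) (hθ0 : Tendsto θ (𝓝[>] 0) (𝓝 τ))
include hf hθm hθτ

/-- Monotonicity alone suffices: it makes `θ` measurable and confines its values to a compact subset
of `(τ, ∞)`, where `f` is bounded. -/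
lemma intervalIntegrable_comp_monotone {p z : ℝ} (hp : 0 < p) (hz : 0 < z) :
    IntervalIntegrable (fun x => f (θ x)) volume p z := by
  have hsub : uIoc p z ⊆ Ioi 0 := fun x hx => (lt_min hp hz).trans hx.1
  rw [intervalIntegrable_iff]
  have hm : 0 < min p z := lt_min hp hz
  obtain ⟨C, hC⟩ := (isCompact_Icc (a := θ (min p z)) (b := θ (max p z))).exists_bound_of_continuousOn
    (hf.mono fun v hv => (hθτ _ hm).trans_le hv.1)
  have hfin : IsFiniteMeasure (volume.restrict (uIoc p z)) := ⟨by simp [uIoc]⟩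
  refine Integrable.of_bound ?_ C ?_
  · have h1 : AEMeasurable θ (volume.restrict (uIoc p z)) :=
      aemeasurable_restrict_of_monotoneOn measurableSet_uIoc (hθm.monotoneOn.mono hsub)
    have h2 := (measurable_indicator_of_continuousOn hf).comp_aemeasurable h1
    refine (h2.congr ?_).aestronglyMeasurable
    filter_upwards [ae_restrict_mem measurableSet_uIoc] with x hx
    exact indicator_of_mem (show θ x ∈ Ioi τ from hθτ x (hsub hx)) f
  · filter_upwards [ae_restrict_mem measurableSet_uIoc] with x hx
    exact hC _ ⟨hθm.monotoneOn hm (hsub hx) hx.1.le,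
      hθm.monotoneOn (hsub hx) (hm.trans_le min_le_max) hx.2⟩

include hθ0

/-- If replacing the integrand by its composition with `θ` only reparametrises the beta average
with a fixed left end, then `θ` is affine. -/
theorem affine_of_betaAvg_comp_right (a : ℕ)
    (hne : ∀ v, τ < v → NonzeroRightLimit (fun u => deriv (fun v => betaAvg a 0 f u v) v) τ)
    (hid : ∀ p z, 0 < p → p < z →
      betaAvg a 0 (fun x => f (θ x)) p z = betaAvg a 0 f (θ p) (θ z)) :
    ∃ c > 0, ∀ z, 0 < z → θ z = τ + c * z := by
  have hθp : ∀ {P : ℝ → Prop}, (∀ᶠ u in 𝓝 τ, τ < u → P u) → ∀ᶠ p in 𝓝[>] 0, P (θ p) := by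
    intro P hP
    filter_upwards [hθ0.eventually hP, self_mem_nhdsWithin] with p hp hp0
    exact hp (hθτ p hp0)
  -- A single small `p` works for the whole compact range of `θ` around `z`: the average from `θ p`
  -- is then injective there, and composed with `θ` it is an integral continuous in its upper end.
  have hcont : ∀ z, 0 < z → ContinuousAt θ z := by
    intro z hz
    have hz2 : 0 < z / 2 := by linarith
    have hK : ∀ᶠ u in 𝓝 τ, ∀ v ∈ Icc (θ (z / 2)) (θ (z + 1)), τ < u →
        f v - (a + 1) * betaAvg a 0 f u v ≠ 0 :=
      isCompact_Icc.eventually_forall_of_forall_eventually fun v hv =>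
        eventually_deriv_betaAvg_ne_zero a hf ((hθτ _ hz2).trans_le hv.1)
          (hne v ((hθτ _ hz2).trans_le hv.1))
    have hK' : ∀ᶠ u in 𝓝 τ, τ < u → ∀ v ∈ Icc (θ (z / 2)) (θ (z + 1)),
        f v - (a + 1) * betaAvg a 0 f u v ≠ 0 := hK.mono fun u hu h v hv => hu v hv h
    obtain ⟨p, hp1, hp2⟩ := ((hθp hK').and (Ioo_mem_nhdsGT hz2)).exists
    have hmono := hθm hp2.1 hz2 hp2.2
    have hder : ∀ v ∈ Icc (θ (z / 2)) (θ (z + 1)), HasDerivAt (fun v => betaAvg a 0 f (θ p) v)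
        ((f v - (a + 1) * betaAvg a 0 f (θ p) v) / (v - θ p)) v := fun v hv =>
      hasDerivAt_betaAvg_right_of_continuousOn a (hθτ p hp2.1) (hmono.trans_le hv.1) hf
    refine continuousAt_of_comp_injOn isCompact_Icc (fun v hv => (hder v hv).continuousAt)
      (injOn_of_hasDerivAt_ne_zero ordConnected_Icc hder fun v hv =>
        div_ne_zero (hp1 v hv) (sub_ne_zero.2 (hmono.trans_le hv.1).ne')) ?_ ?_
    · filter_upwards [Ioo_mem_nhds (by linarith : z / 2 < z) (by linarith : z < z + 1)] with y hy
      exact ⟨(hθm hz2 (hz2.trans hy.1) hy.1).le,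
        (hθm (hz2.trans hy.1) (by simp; linarith) hy.2).le⟩
    · have hpz : p < z := by linarith [hp2.2]
      refine (continuousAt_betaAvg_right_of_integrable a hpz (lt_add_one z)
        (intervalIntegrable_comp_monotone hf hθm hθτ hp2.1 (by linarith))).congr ?_
      filter_upwards [lt_mem_nhds hpz] with y hy
      exact hid p y hp2.1 hy
  have hfθ : ContinuousOn (fun x => f (θ x)) (Ioi 0) := fun z hz =>
    (ContinuousAt.comp (f := θ) (hf.continuousAt (Ioi_mem_nhds (hθτ z hz)))
      (hcont z hz)).continuousWithinAt
  have hder : ∀ z, 0 < z → HasDerivAt θ ((θ z - τ) / z) z := by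
    intro z hz
    have hev : ∀ᶠ u in 𝓝 τ, τ < u → f (θ z) - (a + 1) * betaAvg a 0 f u (θ z) ≠ 0 := by
      have h1 := eventually_deriv_betaAvg_ne_zero a hf (hθτ z hz) (hne _ (hθτ z hz))
      have h2 : ContinuousAt (fun u : ℝ => (u, θ z)) τ := by fun_prop
      exact h2.eventually h1
    -- The identity makes the numerators of both endpoint derivatives equal; being nonzero, they
    -- cancel and leave the chord slope.
    have hd : ∀ᶠ p in 𝓝[>] 0, deriv θ z = (θ z - θ p) / (z - p) ∧ DifferentiableAt ℝ θ z := by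
      filter_upwards [hθp hev, Ioo_mem_nhdsGT hz] with p hp1 hp2
      have hmono := hθm hp2.1 hz hp2.2
      have h1 := hasDerivAt_betaAvg_right_of_continuousOn a (hθτ p hp2.1) hmono hf
      have h2 := hasDerivAt_betaAvg_right_of_continuousOn a hp2.1 hp2.2 hfθ
      have h3 : HasDerivAt (fun y => betaAvg a 0 f (θ p) (θ y))
          ((f (θ z) - (a + 1) * betaAvg a 0 f (θ p) (θ z)) / (z - p)) z := by
        rw [hid p z hp2.1 hp2.2] at h2
        refine h2.congr_of_eventuallyEq ?_
        filter_upwards [lt_mem_nhds hp2.2] with y hy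
        exact (hid p y hp2.1 hy).symm
      have hd1 : θ z - θ p ≠ 0 := sub_ne_zero.2 hmono.ne'
      have hd2 : z - p ≠ 0 := sub_ne_zero.2 hp2.2.ne'
      have h4 := hasDerivAt_of_comp (hcont z hz) h1 (div_ne_zero hp1 hd1) h3
      refine ⟨?_, h4.differentiableAt⟩
      rw [h4.deriv]
      field_simp
    have hlim : Tendsto (fun p => (θ z - θ p) / (z - p)) (𝓝[>] 0) (𝓝 ((θ z - τ) / (z - 0))) :=
      (tendsto_const_nhds.sub hθ0).div (tendsto_const_nhds.sub
        (tendsto_id.mono_left nhdsWithin_le_nhds)) (by simpa using hz.ne')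
    have heq : deriv θ z = (θ z - τ) / z := by
      rw [sub_zero] at hlim
      refine tendsto_nhds_unique (tendsto_const_nhds (x := deriv θ z) (f := 𝓝[>] (0 : ℝ))) ?_
      exact hlim.congr' (hd.mono fun p hp => hp.1.symm)
    obtain ⟨p, hp⟩ := hd.exists
    rw [← heq]
    exact hp.2.hasDerivAt
  have hconst : ∀ z, 0 < z → (θ z - τ) / z = (θ 1 - τ) / 1 := by
    intro z hz
    have hq : ∀ y ∈ Ioi (0 : ℝ), HasDerivAt (fun y => (θ y - τ) / y) 0 y := by
      intro y hy
      have hy0 : y ≠ 0 := (show 0 < y from hy).ne'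
      refine (((hder y hy).sub_const τ).div (hasDerivAt_id y) hy0).congr_deriv ?_
      simp only [id]
      field_simp
      ring
    exact isOpen_Ioi.is_const_of_deriv_eq_zero isPreconnected_Ioi
      (fun y hy => (hq y hy).differentiableAt.differentiableWithinAt)
      (fun y hy => (hq y hy).deriv) hz (one_pos : (0 : ℝ) < 1)
  refine ⟨θ 1 - τ, sub_pos.2 (hθτ 1 one_pos), fun z hz => ?_⟩
  have := hconst z hz
  rw [div_one, div_eq_iff hz.ne'] at this
  linarith

/-- If replacing the integrand by its composition with `θ` only reparametrises two consecutive
beta averages, then `θ` is affine. -/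
theorem affine_of_betaAvg_comp_left (a b : ℕ)
    (hne : ∀ v, τ < v → NonzeroRightLimit (fun u => deriv (fun u => betaAvg (a + 1) b f u v) u) τ)
    (hid : ∀ p z, 0 < p → p < z →
      betaAvg (a + 1) b (fun x => f (θ x)) p z = betaAvg (a + 1) b f (θ p) (θ z))
    (hid' : ∀ p z, 0 < p → p < z →
      betaAvg a b (fun x => f (θ x)) p z = betaAvg a b f (θ p) (θ z)) :
    ∃ c > 0, ∀ z, 0 < z → θ z = τ + c * z := by
  set N : ℝ → ℝ → ℝ := fun u v =>
    (a + b + 2 : ℝ) * betaAvg (a + 1) b f u v - (a + 1) * betaAvg a b f u v with hN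
  have hB : ∀ u v, τ < u → u < v →
      HasDerivAt (fun u => betaAvg (a + 1) b f u v) (N u v / (v - u)) u := by
    intro u v hu huv
    obtain ⟨c, hc1, hc2⟩ := exists_between hu
    exact hasDerivAt_betaAvg_left_of_integrable a b hc2 huv
      ((hf.mono fun w hw => (lt_min hc1 (hu.trans huv)).trans_le hw.1).intervalIntegrable)
  have hBθ : ∀ p z, 0 < p → p < z → HasDerivAt (fun p => betaAvg (a + 1) b f (θ p) (θ z))
      (N (θ p) (θ z) / (z - p)) p := by
    intro p z hp hpz
    have h1 := hasDerivAt_betaAvg_left_of_integrable a b (half_lt_self hp) hpz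
      (intervalIntegrable_comp_monotone hf hθm hθτ (half_pos hp) (hp.trans hpz))
    rw [hid p z hp hpz, hid' p z hp hpz] at h1
    refine h1.congr_of_eventuallyEq ?_
    filter_upwards [Ioo_mem_nhds hp hpz] with q hq
    exact (hid q z hq.1 hq.2).symm
  have hder : ∀ z, 0 < z → ∀ᶠ q in 𝓝[>] (0 : ℝ), ∀ p ∈ Ioo 0 q,
      HasDerivAt θ ((θ z - θ p) / (z - p)) p := by
    intro z hz
    -- The derivative is now taken in the variable that tends to `τ`, so the condition at the fixed
    -- right end `θ z` is enough and no uniformity in the right end is required.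
    have hev : ∀ᶠ u in 𝓝[>] τ, ∀ w ∈ Ioo τ u, N w (θ z) ≠ 0 := by
      obtain ⟨ε, hε, h⟩ := (hne _ (hθτ z hz)).exists_le_abs
      obtain ⟨u, hu, hu'⟩ := mem_nhdsGT_iff_exists_Ioo_subset.1
        (h.and (Ioo_mem_nhdsGT (hθτ z hz)))
      filter_upwards [Ioo_mem_nhdsGT hu] with y hy w hw h0
      obtain ⟨h1, h2⟩ := hu' ⟨hw.1, hw.2.trans hy.2⟩
      rw [(hB w _ hw.1 h2.2).deriv, h0] at h1
      simp only [zero_div, abs_zero] at h1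
      linarith
    have hev' : ∀ᶠ q in 𝓝[>] (0 : ℝ), ∀ w ∈ Ioo τ (θ q), N w (θ z) ≠ 0 := by
      have : Tendsto θ (𝓝[>] 0) (𝓝[>] τ) := tendsto_nhdsWithin_iff.2
        ⟨hθ0, by filter_upwards [self_mem_nhdsWithin] with p hp using hθτ p hp⟩
      exact this.eventually hev
    filter_upwards [hev', Ioo_mem_nhdsGT hz] with q hq hqz p hp
    have hpz : p < z := hp.2.trans hqz.2
    have hmz := hθm hp.1 hz hpz
    have hne' : N (θ p) (θ z) ≠ 0 := hq _ ⟨hθτ p hp.1, hθm hp.1 hqz.1 hp.2⟩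
    have hp2 : 0 < p / 2 := half_pos hp.1
    have hpq : (p + q) / 2 < q := by linarith [hp.2]
    have hpq0 : 0 < (p + q) / 2 := by linarith [hp.1, hqz.1]
    have hKsub : ∀ v ∈ Icc (θ (p / 2)) (θ ((p + q) / 2)), v ∈ Ioo τ (θ q) := fun v hv =>
      ⟨(hθτ _ hp2).trans_le hv.1, hv.2.trans_lt (hθm hpq0 hqz.1 hpq)⟩
    have hqθ := hθm hqz.1 hz hqz.2
    have hderK : ∀ v ∈ Icc (θ (p / 2)) (θ ((p + q) / 2)),
        HasDerivAt (fun u => betaAvg (a + 1) b f u (θ z)) (N v (θ z) / (θ z - v)) v := fun v hv =>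
      hB v _ (hKsub v hv).1 ((hKsub v hv).2.trans hqθ)
    have hc : ContinuousAt θ p := by
      refine continuousAt_of_comp_injOn isCompact_Icc (fun v hv => (hderK v hv).continuousAt)
        (injOn_of_hasDerivAt_ne_zero ordConnected_Icc hderK fun v hv =>
          div_ne_zero (hq v (hKsub v hv)) (sub_ne_zero.2 ((hKsub v hv).2.trans hqθ).ne')) ?_
        (hBθ p z hp.1 hpz).continuousAt
      filter_upwards [Ioo_mem_nhds (half_lt_self hp.1) (by linarith [hp.2] : p < (p + q) / 2)]
        with y hy
      exact ⟨(hθm hp2 (hp2.trans hy.1) hy.1).le, (hθm (hp2.trans hy.1) hpq0 hy.2).le⟩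
    have hd1 : θ z - θ p ≠ 0 := sub_ne_zero.2 hmz.ne'
    have hd2 : z - p ≠ 0 := sub_ne_zero.2 hpz.ne'
    refine (hasDerivAt_of_comp hc (hB _ _ (hθτ p hp.1) hmz) (div_ne_zero hne' hd1)
      (hBθ p z hp.1 hpz)).congr_deriv ?_
    field_simp
  -- Since `θ'` at `p` is the slope of the chord from `p` to `z`, that slope has zero derivative in
  -- `p`; its constant value is found by letting `p → 0`.
  have hslope : ∀ z, 0 < z → ∀ᶠ q in 𝓝[>] (0 : ℝ), deriv θ q = (θ z - τ) / z := by
    intro z hz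
    obtain ⟨q, hq, hqz⟩ := ((hder z hz).and (Ioo_mem_nhdsGT hz)).exists
    have hD : ∀ y ∈ Ioo 0 q, HasDerivAt (fun p => (θ z - θ p) / (z - p)) 0 y := by
      intro y hy
      have hd : z - y ≠ 0 := sub_ne_zero.2 (hy.2.trans hqz.2).ne'
      refine (((hq y hy).const_sub (θ z)).div ((hasDerivAt_id y).const_sub z) hd).congr_deriv ?_
      simp only [id]
      field_simp
      ring
    have hconst : ∀ x ∈ Ioo 0 q, ∀ y ∈ Ioo 0 q, (θ z - θ x) / (z - x) = (θ z - θ y) / (z - y) :=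
      fun x hx y hy => isOpen_Ioo.is_const_of_deriv_eq_zero isPreconnected_Ioo
        (fun y hy => (hD y hy).differentiableAt.differentiableWithinAt)
        (fun y hy => (hD y hy).deriv) hx hy
    have hlim : Tendsto (fun p => (θ z - θ p) / (z - p)) (𝓝[>] 0) (𝓝 ((θ z - τ) / (z - 0))) :=
      (tendsto_const_nhds.sub hθ0).div (tendsto_const_nhds.sub
        (tendsto_id.mono_left nhdsWithin_le_nhds)) (by simpa using hz.ne')
    rw [sub_zero] at hlim
    filter_upwards [Ioo_mem_nhdsGT hqz.1] with x hx
    rw [(hq x hx).deriv]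
    refine tendsto_nhds_unique (tendsto_const_nhds (f := 𝓝[>] (0 : ℝ))) (hlim.congr' ?_)
    filter_upwards [Ioo_mem_nhdsGT hqz.1] with y hy using hconst y hy x hx
  refine ⟨θ 1 - τ, sub_pos.2 (hθτ 1 one_pos), fun z hz => ?_⟩
  -- The derivative of `θ` at one common small `q` compares the ratios for `z` and for `1`.
  obtain ⟨q, h1, h2⟩ := ((hslope z hz).and (hslope 1 one_pos)).exists
  have := h1.symm.trans h2
  rw [div_one, div_eq_iff hz.ne'] at this
  linarith

end

/-! ### From almost every pair of endpoints to every pair -/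

lemma tendsto_betaAvg_of_left (a b : ℕ) {m lo hi C : ℝ} {g : ℝ → ℝ}
    (hgm : Measurable ((Ioi m).indicator g)) (hlo : m < lo)
    (hgl : ∀ x, m < x → ContinuousWithinAt g (Iic x) x) (hC : ∀ x ∈ Icc lo hi, |g x| ≤ C)
    {p z : ℝ} {ps zs : ℕ → ℝ} (hp : Tendsto ps atTop (𝓝 p)) (hz : Tendsto zs atTop (𝓝 z))
    (hps : ∀ n, ps n ∈ Icc lo p) (hzs : ∀ n, zs n ∈ Icc lo z) (hphi : p ≤ hi) (hzhi : z ≤ hi) :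
    Tendsto (fun n => betaAvg a b g (ps n) (zs n)) atTop (𝓝 (betaAvg a b g p z)) := by
  have hI : uIoc (0 : ℝ) 1 ⊆ Icc 0 1 := by
    rw [uIoc_of_le zero_le_one]; exact Ioc_subset_Icc_self
  have hmem : ∀ n, ∀ x ∈ Icc (0 : ℝ) 1, ps n + (zs n - ps n) * x ∈ Icc lo hi := by
    intro n x hx
    have := (convex_Icc lo hi).add_smul_sub_mem
      (show ps n ∈ _ from ⟨(hps n).1, (hps n).2.trans hphi⟩)
      (show zs n ∈ _ from ⟨(hzs n).1, (hzs n).2.trans hzhi⟩) hx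
    simpa [mul_comm] using this
  have hplo : lo ≤ p := (hps 0).1.trans (hps 0).2
  have hzlo : lo ≤ z := (hzs 0).1.trans (hzs 0).2
  refine intervalIntegral.tendsto_integral_filter_of_dominated_convergence (fun _ => C) ?_ ?_
    intervalIntegrable_const ?_
  · refine Eventually.of_forall fun n => ?_
    have h1 : Measurable fun x : ℝ =>
        x ^ a * (1 - x) ^ b * (Ioi m).indicator g (ps n + (zs n - ps n) * x) :=
      (by fun_prop : Measurable fun x : ℝ => x ^ a * (1 - x) ^ b).mul (hgm.comp (by fun_prop))
    refine h1.aestronglyMeasurable.congr ?_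
    filter_upwards [ae_restrict_mem measurableSet_uIoc] with x hx
    rw [indicator_of_mem (show _ ∈ Ioi m from hlo.trans_le (hmem n x (hI hx)).1)]
  · refine Eventually.of_forall fun n => ae_of_all _ fun x hx => ?_
    obtain ⟨h0, h1⟩ := hI hx
    have hw : x ^ a * (1 - x) ^ b ≤ 1 := mul_le_one₀ (pow_le_one₀ h0 h1)
      (pow_nonneg (sub_nonneg.2 h1) _) (pow_le_one₀ (sub_nonneg.2 h1) (by linarith))
    rw [norm_mul, Real.norm_of_nonneg (mul_nonneg (pow_nonneg h0 _)
      (pow_nonneg (sub_nonneg.2 h1) _))]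
    exact (mul_le_of_le_one_left (norm_nonneg _) hw).trans (hC _ (hmem n x (hI hx)))
  · refine ae_of_all _ fun x hx => ?_
    obtain ⟨h0, h1⟩ := hI hx
    have hmx : m < p + (z - p) * x :=
      segment_mem (hlo.trans_le hplo) (hlo.trans_le hzlo) (hI hx)
    refine ((hgl _ hmx).tendsto.comp (tendsto_nhdsWithin_iff.2
      ⟨hp.add ((hz.sub hp).mul_const x), Eventually.of_forall fun n => ?_⟩)).const_mul _
    -- Both endpoints approach from below, hence so does every point dividing the segment in a fixed
    -- ratio, and left continuity of `g` suffices.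
    have e1 := mul_le_mul_of_nonneg_right (hps n).2 (sub_nonneg.2 h1)
    have e2 := mul_le_mul_of_nonneg_right (hzs n).2 h0
    simp only [mem_Iic]
    linarith

lemma exists_mem_Ioo_of_ae {P : ℝ → Prop} {c x y : ℝ} (hP : ∀ᵐ s ∂(volume.restrict (Ioi c)), P s)
    (hcx : c ≤ x) (hxy : x < y) : ∃ s ∈ Ioo x y, P s := by
  have h1 : ∀ᵐ s ∂(volume.restrict (Ioo x y)), P s :=
    ae_restrict_of_ae_restrict_of_subset (fun s hs => hcx.trans_lt hs.1) hP
  have hne : (ae (volume.restrict (Ioo x y))).NeBot := by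
    rw [ae_neBot, Ne, Measure.restrict_eq_zero, Real.volume_Ioo]
    simpa using hxy
  exact ((ae_restrict_mem measurableSet_Ioo).and h1).exists

/-- An identity between beta averages that holds almost everywhere holds everywhere, when the
reparametrisation is continuous from the left. -/
lemma betaAvg_comp_eq_of_ae (a b : ℕ) {τ : ℝ} {f θ : ℝ → ℝ} (hf : ContinuousOn f (Ioi τ))
    (hθm : StrictMonoOn θ (Ioi 0)) (hθτ : ∀ z, 0 < z → τ < θ z)
    (hθl : ∀ z, 0 < z → ContinuousWithinAt θ (Iic z) z)
    (hae : ∀ᵐ s ∂(volume.restrict (Ioi (0 : ℝ))), ∀ᵐ t ∂(volume.restrict (Ioi s)),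
      betaAvg a b (fun x => f (θ x)) s t = betaAvg a b f (θ s) (θ t))
    {p z : ℝ} (hp : 0 < p) (hpz : p < z) :
    betaAvg a b (fun x => f (θ x)) p z = betaAvg a b f (θ p) (θ z) := by
  have hz : 0 < z := hp.trans hpz
  -- Good pairs converge to `(p, z)` from below; the bounds `p / 2` and `p` keep them away from `0`
  -- and keep `s < t`.
  have hseq : ∀ n : ℕ, ∃ s t, s ∈ Ioo (max (p / 2) (p - 1 / (n + 1))) p ∧
      t ∈ Ioo (max p (z - 1 / (n + 1))) z ∧
      betaAvg a b (fun x => f (θ x)) s t = betaAvg a b f (θ s) (θ t) := by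
    intro n
    have hn : (0 : ℝ) < 1 / (n + 1) := by positivity
    obtain ⟨s, hs, hs'⟩ := exists_mem_Ioo_of_ae hae (x := max (p / 2) (p - 1 / (n + 1))) (y := p)
      (le_max_of_le_left (by linarith)) (max_lt (by linarith) (by linarith))
    obtain ⟨t, ht, ht'⟩ := exists_mem_Ioo_of_ae hs' (x := max p (z - 1 / (n + 1))) (y := z)
      (le_max_of_le_left hs.2.le) (max_lt hpz (by linarith))
    exact ⟨s, t, hs, ht, ht'⟩
  choose s t hs ht hst using hseq
  have hlim : ∀ {y : ℝ} {ys : ℕ → ℝ}, (∀ n : ℕ, y - 1 / (n + 1) ≤ ys n) → (∀ n, ys n ≤ y) →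
      Tendsto ys atTop (𝓝 y) := by
    intro y ys h1 h2
    refine tendsto_of_tendsto_of_tendsto_of_le_of_le ?_ tendsto_const_nhds h1 h2
    simpa using (tendsto_one_div_add_atTop_nhds_zero_nat (𝕜 := ℝ)).const_sub y
  have hsl : Tendsto s atTop (𝓝 p) :=
    hlim (fun n => (le_max_right _ _).trans (hs n).1.le) fun n => (hs n).2.le
  have htl : Tendsto t atTop (𝓝 z) :=
    hlim (fun n => (le_max_right _ _).trans (ht n).1.le) fun n => (ht n).2.le
  have hs2 : ∀ n, s n ∈ Icc (p / 2) p := fun n =>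
    ⟨(le_max_left _ _).trans (hs n).1.le, (hs n).2.le⟩
  have ht2 : ∀ n, t n ∈ Icc (p / 2) z := fun n =>
    ⟨by linarith [(le_max_left _ _).trans (ht n).1.le], (ht n).2.le⟩
  have hp2 : 0 < p / 2 := half_pos hp
  have hmono : ∀ {x y : ℝ}, 0 < x → x ≤ y → θ x ≤ θ y := fun hx hxy =>
    hθm.monotoneOn hx (hx.trans_le hxy) hxy
  obtain ⟨C, hC⟩ := (isCompact_Icc (a := θ (p / 2)) (b := θ z)).exists_bound_of_continuousOn
    (hf.mono fun v hv => (hθτ _ hp2).trans_le hv.1)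
  have hfm := measurable_indicator_of_continuousOn hf
  have hL : Tendsto (fun n => betaAvg a b (fun x => f (θ x)) (s n) (t n)) atTop
      (𝓝 (betaAvg a b (fun x => f (θ x)) p z)) := by
    refine tendsto_betaAvg_of_left a b (m := 0) (lo := p / 2) (hi := z) (C := C) ?_ hp2 ?_ ?_
      hsl htl hs2 ht2 hpz.le le_rfl
    -- Extending `θ` by `τ` keeps it monotone, hence measurable, and the indicator of `(τ, ∞)`
    -- removes the added part.
    · have hθmeas : Measurable (fun x => if 0 < x then θ x else τ) := by
        refine Monotone.measurable fun x y hxy => ?_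
        split_ifs with h1 h2 h2
        · exact hmono h1 hxy
        · exact absurd (h1.trans_le hxy) h2
        · exact (hθτ y h2).le
        · exact le_rfl
      convert! hfm.comp hθmeas using 1
      ext x
      by_cases hx : 0 < x
      · simp [hx, hθτ x hx]
      · simp [hx]
    · intro x hx
      exact ContinuousAt.comp_continuousWithinAt (f := θ)
        (hf.continuousAt (Ioi_mem_nhds (hθτ x hx))) (hθl x hx)
    · intro x hx
      exact hC _ ⟨hmono hp2 hx.1, hmono (hp2.trans_le hx.1) hx.2⟩
  have hR : Tendsto (fun n => betaAvg a b f (θ (s n)) (θ (t n))) atTop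
      (𝓝 (betaAvg a b f (θ p) (θ z))) := by
    have hθlim : ∀ {y : ℝ} {ys : ℕ → ℝ}, 0 < y → Tendsto ys atTop (𝓝 y) → (∀ n, ys n ≤ y) →
        Tendsto (fun n => θ (ys n)) atTop (𝓝 (θ y)) := fun hy h1 h2 =>
      (hθl _ hy).tendsto.comp (tendsto_nhdsWithin_iff.2 ⟨h1, Eventually.of_forall h2⟩)
    exact tendsto_betaAvg_of_left a b (m := τ) (lo := θ (p / 2)) (hi := θ z) (C := C) hfm
      (hθτ _ hp2) (fun x hx => (hf.continuousAt (Ioi_mem_nhds hx)).continuousWithinAt)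
      (fun x hx => hC x hx) (hθlim hp hsl fun n => (hs2 n).2) (hθlim hz htl fun n => (ht2 n).2)
      (fun n => ⟨hmono hp2 (hs2 n).1, hmono (hp2.trans_le (hs2 n).1) (hs2 n).2⟩)
      (fun n => ⟨hmono hp2 (ht2 n).1, hmono (hp2.trans_le (ht2 n).1) (ht2 n).2⟩)
      (hmono hp hpz.le) le_rfl
  simp only [hst] at hL
  exact tendsto_nhds_unique hL hR

/-! ### Conditional means as beta averages -/

lemma integral_betaLaw (a b : ℕ) (g : ℝ → ℝ) :
    ∫ x, g x ∂(betaLaw a b) =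
      (a + b + 1)! / (a ! * b !) * ∫ x in (0 : ℝ)..1, x ^ a * (1 - x) ^ b * g x := by
  rw [betaLaw, integral_withDensity_eq_integral_toReal_smul (by fun_prop)
    (ae_of_all _ fun _ => ENNReal.ofReal_lt_top), intervalIntegral.integral_of_le zero_le_one,
    integral_Ioc_eq_integral_Ioo, ← integral_const_mul]
  refine setIntegral_congr_fun measurableSet_Ioo fun x hx => ?_
  have h0 : 0 ≤ x := hx.1.le
  have h1 : 0 ≤ 1 - x := sub_nonneg.2 hx.2.le
  simp only [smul_eq_mul]
  rw [ENNReal.toReal_ofReal (by positivity)]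
  ring

lemma ae_betaLaw_mem (a b : ℕ) : ∀ᵐ x ∂(betaLaw a b), x ∈ Ioo (0 : ℝ) 1 :=
  (withDensity_absolutelyContinuous _ _).ae_le (ae_restrict_mem measurableSet_Ioo)

/-- The mean of a continuous function under the conditional law of a record value. -/
lemma integral_recordKernel {G : ℝ → ℝ} (hG : IsContCDF G) (a b : ℕ) {ψ : ℝ → ℝ}
    (hψ : ContinuousOn ψ (openRange G))
    (hbdd : ∀ x y, 0 < x → ∃ C, ∀ q ∈ Icc x y, |ψ (hazardQuantile G q)| ≤ C) {s t : ℝ}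
    (hs : s ∈ openRange G) (hst : cumHazard G s < cumHazard G t) :
    Integrable ψ (recordKernel G a b (s, t)) ∧
      ∫ y, ψ y ∂(recordKernel G a b (s, t)) = (a + b + 1)! / (a ! * b !) *
        betaAvg a b (fun q => ψ (hazardQuantile G q)) (cumHazard G s) (cumHazard G t) := by
  have hs0 := hG.cumHazard_pos hs
  have hm : Measurable (hazardInterp G s t) :=
    hG.measurable_hazardInterp measurable_const measurable_const measurable_id
  have hseg : ∀ x ∈ Ioo (0 : ℝ) 1, cumHazard G s + (cumHazard G t - cumHazard G s) * x ∈
      Icc (cumHazard G s) (cumHazard G t) := by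
    intro x hx
    have hd := sub_pos.2 hst
    constructor <;> nlinarith [hx.1, hx.2]
  have hmem : ∀ᵐ y ∂((betaLaw a b).map (hazardInterp G s t)), y ∈ openRange G := by
    refine (ae_map_iff (p := fun y => y ∈ openRange G) hm.aemeasurable
      hG.isOpen_openRange.measurableSet).2 ?_
    filter_upwards [ae_betaLaw_mem a b] with x hx
    exact hG.hazardQuantile_mem (hs0.trans_le (hseg x hx).1)
  have hsm : AEStronglyMeasurable ψ ((betaLaw a b).map (hazardInterp G s t)) := by
    rw [← Measure.restrict_eq_self_of_ae_mem hmem]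
    exact hψ.aestronglyMeasurable hG.isOpen_openRange.measurableSet
  obtain ⟨C, hC⟩ := hbdd (cumHazard G s) (cumHazard G t) hs0
  rw [recordKernel_apply hG]
  constructor
  · refine Integrable.of_bound hsm C ?_
    have hms : MeasurableSet {y | ‖(openRange G).indicator ψ y‖ ≤ C} := by
      classical
      refine measurableSet_le (Measurable.norm ?_) measurable_const
      rw [← piecewise_eq_indicator]
      exact hψ.measurable_piecewise continuousOn_const hG.isOpen_openRange.measurableSet
    have h1 : ∀ᵐ y ∂((betaLaw a b).map (hazardInterp G s t)),
        ‖(openRange G).indicator ψ y‖ ≤ C := by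
      rw [ae_map_iff hm.aemeasurable hms]
      filter_upwards [ae_betaLaw_mem a b] with x hx
      rw [indicator_of_mem (show hazardInterp G s t x ∈ openRange G from
        hG.hazardQuantile_mem (hs0.trans_le (hseg x hx).1))]
      exact hC _ (hseg x hx)
    filter_upwards [h1, hmem] with y hy hy'
    rwa [indicator_of_mem hy'] at hy
  · rw [integral_map hm.aemeasurable hsm, integral_betaLaw]
    rfl

/-! ### The transform `T` in hazard coordinates -/

section transform

variable {G T : ℝ → ℝ} {τ : ℝ} (hG : IsContCDF G)
include hG

lemma strictMonoOn_comp_hazardQuantile (hTm : StrictMonoOn T (openRange G)) :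
    StrictMonoOn (fun q => T (hazardQuantile G q)) (Ioi 0) := fun _ hx _ hy hxy =>
  hTm (hG.hazardQuantile_mem hx) (hG.hazardQuantile_mem hy)
    (hG.hazardQuantile_strictMonoOn hx hy hxy)

lemma tendsto_comp_hazardQuantile_zero
    (hTl : Tendsto T (comap Real.toEReal (𝓝[>] (leftExtremity G))) (𝓝 τ)) :
    Tendsto (fun q => T (hazardQuantile G q)) (𝓝[>] 0) (𝓝 τ) := by
  refine hTl.comp (tendsto_comap_iff.2 (tendsto_nhdsWithin_iff.2 ⟨tendsto_order.2 ⟨?_, ?_⟩, ?_⟩))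
  · intro b hb
    filter_upwards [self_mem_nhdsWithin] with q hq
    exact hb.trans (hG.hazardQuantile_mem hq).1
  · intro b hb
    obtain ⟨_, ⟨y, hy, rfl⟩, hyb⟩ := sInf_lt_iff.1 hb
    have h1 : ∀ᶠ q in 𝓝[>] (0 : ℝ), 1 - Real.exp (-q) < G y := by
      have h2 : ContinuousAt (fun q : ℝ => 1 - Real.exp (-q)) 0 := by fun_prop
      refine nhdsWithin_le_nhds (h2.eventually (gt_mem_nhds ?_))
      simpa using hy
    filter_upwards [h1, self_mem_nhdsWithin] with q hq hq0
    exact (EReal.coe_le_coe_iff.2 ((hG.hazardQuantile_le_iff hq0).2 hq.le)).trans_lt hyb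
  · filter_upwards [self_mem_nhdsWithin] with q hq
    exact (hG.hazardQuantile_mem hq).1

lemma tendsto_comp_hazardQuantile_atTop
    (hTr : Tendsto T (comap Real.toEReal (𝓝[<] (rightExtremity G))) atTop) :
    Tendsto (fun q => T (hazardQuantile G q)) atTop atTop := by
  refine hTr.comp (tendsto_comap_iff.2 (tendsto_nhdsWithin_iff.2 ⟨tendsto_order.2 ⟨?_, ?_⟩, ?_⟩))
  · intro b hb
    obtain ⟨_, ⟨y, hy, rfl⟩, hyb⟩ := lt_sSup_iff.1 hb
    filter_upwards [eventually_gt_atTop (0 : ℝ), eventually_gt_atTop (cumHazard G y)] with q h0 hq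
    exact hyb.trans (EReal.coe_lt_coe_iff.2 ((hG.lt_hazardQuantile_iff_cumHazard h0 hy).2 hq))
  · intro b hb
    filter_upwards [eventually_gt_atTop (0 : ℝ)] with q hq
    exact (hG.hazardQuantile_mem hq).2.trans hb
  · filter_upwards [eventually_gt_atTop (0 : ℝ)] with q hq
    exact (hG.hazardQuantile_mem hq).2

lemma lt_comp_hazardQuantile (hTm : StrictMonoOn T (openRange G))
    (hTl : Tendsto T (comap Real.toEReal (𝓝[>] (leftExtremity G))) (𝓝 τ)) {z : ℝ} (hz : 0 < z) :
    τ < T (hazardQuantile G z) := by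
  have hm := strictMonoOn_comp_hazardQuantile hG hTm
  refine lt_of_le_of_lt ?_ (hm (half_pos hz) hz (half_lt_self hz))
  refine le_of_tendsto (tendsto_comp_hazardQuantile_zero hG hTl) ?_
  filter_upwards [Ioo_mem_nhdsGT (half_pos hz)] with q hq
  exact (hm hq.1 (half_pos hz) hq.2).le

lemma lt_apply_of_mem_openRange (hTm : StrictMonoOn T (openRange G))
    (hTl : Tendsto T (comap Real.toEReal (𝓝[>] (leftExtremity G))) (𝓝 τ)) {y : ℝ}
    (hy : y ∈ openRange G) : τ < T y := by
  have h0 := hG.cumHazard_pos hy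
  have h1 := lt_comp_hazardQuantile hG hTm hTl h0
  refine h1.trans_le (hTm.monotoneOn (hG.hazardQuantile_mem h0) hy ?_)
  rw [hG.hazardQuantile_le_iff h0, exp_neg_cumHazard (hG.mem_openRange.1 hy).2]
  simp

/-- The nonvanishing condition is given at the points `T t`; since `T` increases to infinity, these
exhaust `(τ, ∞)`. -/
lemma exists_apply_eq_of_lt (hTc : ContinuousOn T (openRange G))
    (hTl : Tendsto T (comap Real.toEReal (𝓝[>] (leftExtremity G))) (𝓝 τ))
    (hTr : Tendsto T (comap Real.toEReal (𝓝[<] (rightExtremity G))) atTop) {v : ℝ} (hv : τ < v) :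
    ∃ t ∈ openRange G, T t = v := by
  obtain ⟨p, hp, hp0⟩ := (((tendsto_comp_hazardQuantile_zero hG hTl).eventually
    (gt_mem_nhds hv)).and self_mem_nhdsWithin).exists
  obtain ⟨q, hq, hq0⟩ := (((tendsto_comp_hazardQuantile_atTop hG hTr).eventually_gt_atTop v).and
    (eventually_gt_atTop (0 : ℝ))).exists
  exact hG.ordConnected_openRange.isPreconnected.intermediate_value (hG.hazardQuantile_mem hp0)
    (hG.hazardQuantile_mem hq0) hTc ⟨hp.le, hq.le⟩

lemma continuousWithinAt_comp_hazardQuantile (hTc : ContinuousOn T (openRange G)) {z : ℝ} (hz : 0 < z) :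
    ContinuousWithinAt (fun q => T (hazardQuantile G q)) (Iic z) z :=
  ContinuousAt.comp_continuousWithinAt (f := hazardQuantile G)
    (hTc.continuousAt (hG.isOpen_openRange.mem_nhds (hG.hazardQuantile_mem hz)))
    (hG.hazardQuantile_continuousWithinAt hz)

/-- A point `y` may differ from the quantile of its own hazard when `G` is flat. It lies at or above
that quantile and below every later one; applying `T` and using continuity of the affine map
squeezes `T y`. -/
lemma apply_eq_of_affine (hTm : StrictMonoOn T (openRange G)) {c : ℝ}
    (h : ∀ z, 0 < z → T (hazardQuantile G z) = τ + c * z) {y : ℝ} (hy : y ∈ openRange G) :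
    T y = τ + c * cumHazard G y := by
  have h0 := hG.cumHazard_pos hy
  have h1 := (hG.mem_openRange.1 hy).2
  have hle : hazardQuantile G (cumHazard G y) ≤ y := by
    rw [hG.hazardQuantile_le_iff h0, exp_neg_cumHazard h1]
    simp
  have hlim : Tendsto (fun q => τ + c * q) (𝓝[>] (cumHazard G y))
      (𝓝 (τ + c * cumHazard G y)) :=
    (by fun_prop : ContinuousAt (fun q => τ + c * q) (cumHazard G y)).tendsto.mono_left
      nhdsWithin_le_nhds
  refine le_antisymm (ge_of_tendsto hlim ?_) ?_
  · filter_upwards [self_mem_nhdsWithin] with q hq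
    have hq0 : 0 < q := h0.trans hq
    rw [← h q hq0]
    exact (hTm hy (hG.hazardQuantile_mem hq0)
      ((hG.lt_hazardQuantile_iff_cumHazard hq0 h1).2 hq)).le
  · rw [← h _ h0]
    exact hTm.monotoneOn (hG.hazardQuantile_mem h0) hy hle

/-- `T` is affine in hazard coordinates exactly when `G` is exponential in the scale `T`. -/
lemma exists_affine_iff_exists_exponential (hTm : StrictMonoOn T (openRange G)) :
    (∃ c > 0, ∀ z, 0 < z → T (hazardQuantile G z) = τ + c * z) ↔
      ∃ c : ℝ, 0 < c ∧ ∀ y ∈ openRange G, G y = 1 - Real.exp (-c * (T y - τ)) := by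
  constructor
  · rintro ⟨c, hc, h⟩
    refine ⟨c⁻¹, inv_pos.2 hc, fun y hy => ?_⟩
    have h1 := (hG.mem_openRange.1 hy).2
    have heq := apply_eq_of_affine hG hTm h hy
    have h2 : -c⁻¹ * (T y - τ) = -cumHazard G y := by
      rw [heq]
      field_simp
      ring
    rw [h2, exp_neg_cumHazard h1]
    ring
  · rintro ⟨c, hc, h⟩
    refine ⟨c⁻¹, inv_pos.2 hc, fun z hz => ?_⟩
    have h1 := h _ (hG.hazardQuantile_mem hz)
    rw [hG.apply_hazardQuantile hz] at h1
    have h2 : -z = -c * (T (hazardQuantile G z) - τ) := Real.exp_injective (by linarith)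
    field_simp
    linarith

end transform

lemma ae_forall_apply_lt_one {Ω : Type*} [MeasurableSpace Ω] {P : Measure Ω} {Y : ℕ → Ω → ℝ}
    {μ : Measure ℝ} [IsProbabilityMeasure μ] {G : ℝ → ℝ} (hY : ∀ i, Measurable (Y i))
    (hPμ : ∀ i, P.map (Y i) = μ) (hG : IsContCDF G) (hμ : ∀ y, G y = μ.real (Iic y)) :
    ∀ᵐ ω ∂P, ∀ i, G (Y i ω) < 1 := by
  refine ae_all_iff.2 fun i => ?_
  have h := ae_lt_one hG hμ
  rw [← hPμ i] at h
  exact ae_of_ae_map (hY i).aemeasurable h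

lemma integral_recordKernel_comp {G T : ℝ → ℝ} {τ : ℝ} (hG : IsContCDF G)
    (hTc : ContinuousOn T (openRange G)) (hTm : StrictMonoOn T (openRange G))
    (hTl : Tendsto T (comap Real.toEReal (𝓝[>] (leftExtremity G))) (𝓝 τ)) (a b : ℕ) {f : ℝ → ℝ}
    (hf : ContinuousOn f (Ioi τ)) {s t : ℝ} (hs : s ∈ openRange G)
    (hst : cumHazard G s < cumHazard G t) :
    Integrable (fun y => f (T y)) (recordKernel G a b (s, t)) ∧
      ∫ y, f (T y) ∂(recordKernel G a b (s, t)) = (a + b + 1)! / (a ! * b !) *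
        betaAvg a b (fun q => f (T (hazardQuantile G q))) (cumHazard G s) (cumHazard G t) := by
  refine integral_recordKernel hG a b
    (hf.comp hTc fun y hy => lt_apply_of_mem_openRange hG hTm hTl hy) ?_ hs hst
  intro x y hx
  have hm := (strictMonoOn_comp_hazardQuantile hG hTm).monotoneOn
  obtain ⟨C, hC⟩ := (isCompact_Icc (a := T (hazardQuantile G x))
    (b := T (hazardQuantile G y))).exists_bound_of_continuousOn
    (hf.mono fun v hv => (lt_comp_hazardQuantile hG hTm hTl hx).trans_le hv.1)
  exact ⟨C, fun q hq => hC _ ⟨hm hx (hx.trans_le hq.1) hq.1,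
    hm (hx.trans_le hq.1) ((hx.trans_le hq.1).trans_le hq.2) hq.2⟩⟩

/-! ### Regression identities and the reparametrisation equation -/

section regression

variable {Ω : Type*} [MeasurableSpace Ω] {P : Measure Ω} [IsProbabilityMeasure P]
  {Y : ℕ → Ω → ℝ} {μ : Measure ℝ} [IsProbabilityMeasure μ] {G T : ℝ → ℝ} {τ : ℝ}
  (hY : ∀ i, Measurable (Y i)) (hi : iIndepFun Y P) (hPμ : ∀ i, P.map (Y i) = μ)
  (hG : IsContCDF G) (hμ : ∀ y, G y = μ.real (Iic y))
  (hTc : ContinuousOn T (openRange G)) (hTm : StrictMonoOn T (openRange G))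
  (hTl : Tendsto T (comap Real.toEReal (𝓝[>] (leftExtremity G))) (𝓝 τ))
  (m a b : ℕ) {f : ℝ → ℝ} (hf : ContinuousOn f (Ioi τ)) {C : ℝ}
  (hC : C = (a + b + 1)! / (a ! * b !)) {Ψ : ℝ → ℝ → ℝ}
  (hΨ : ∀ u v, τ < u → u < v → Ψ u v = betaAvg a b f u v)
include hY hi hPμ hG hμ

/-- A regression identity between record values in terms of their explicit conditional law. -/
lemma regressionIdentity_recVal_iff (ψ : ℝ → ℝ) (Φ : ℝ → ℝ → ℝ) :
    RegressionIdentity P (openRange G) (recVal Y m) (recVal Y (m + a + 1 + b + 1))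
        (recVal Y (m + a + 1)) ψ Φ ↔
      ∀ᵐ p ∂(P.map fun ω => (recVal Y m ω, recVal Y (m + a + 1 + b + 1) ω)),
        p.1 ∈ openRange G → p.2 ∈ openRange G → p.1 < p.2 →
          Integrable ψ (recordKernel G a b p) ∧ ∫ y, ψ y ∂(recordKernel G a b p) = Φ p.1 p.2 := by
  have h := condDistrib_recVal hY hi hPμ hG hμ (ae_forall_apply_lt_one hY hPμ hG hμ) m a b
  refine eventually_congr ?_
  filter_upwards [h] with p hp
  rw [hp]

include hTc hTm hTl hf hC hΨ

lemma betaAvg_comp_eq_of_regressionIdentity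
    (h : RegressionIdentity P (openRange G) (recVal Y m) (recVal Y (m + a + 1 + b + 1))
      (recVal Y (m + a + 1)) (fun y => f (T y)) fun s t => C * Ψ (T s) (T t))
    {p z : ℝ} (hp : 0 < p) (hpz : p < z) :
    betaAvg a b (fun q => f (T (hazardQuantile G q))) p z =
      betaAvg a b f (T (hazardQuantile G p)) (T (hazardQuantile G z)) := by
  have hlt := ae_forall_apply_lt_one hY hPμ hG hμ
  have h1 := (regressionIdentity_recVal_iff hY hi hPμ hG hμ m a b _ _).1 h
  have h2 : ∀ᵐ s ∂(volume.restrict (Ioi (0 : ℝ))), ∀ᵐ t ∂(volume.restrict (Ioi s)), _ :=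
    ae_ae_of_ae_map_recVal hY hi hPμ hG hμ hlt m (a + b + 1)
      (by rw [show m + (a + b + 1) + 1 = m + a + 1 + b + 1 by ring]; exact h1)
  refine betaAvg_comp_eq_of_ae a b hf (strictMonoOn_comp_hazardQuantile hG hTm)
    (fun _ hz => lt_comp_hazardQuantile hG hTm hTl hz)
    (fun _ hz => continuousWithinAt_comp_hazardQuantile hG hTc hz) ?_ hp hpz
  filter_upwards [h2, ae_restrict_mem measurableSet_Ioi] with s hs hs0
  filter_upwards [hs, ae_restrict_mem measurableSet_Ioi] with t ht hst
  have hs0' : 0 < s := hs0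
  have ht0 : 0 < t := hs0'.trans hst
  have h3 := (ht (hG.hazardQuantile_mem hs0') (hG.hazardQuantile_mem ht0)
    (hG.hazardQuantile_strictMonoOn hs0' ht0 hst)).2
  have h4 := (integral_recordKernel_comp hG hTc hTm hTl a b hf (hG.hazardQuantile_mem hs0')
    (t := hazardQuantile G t) (by
      rw [hG.cumHazard_hazardQuantile hs0', hG.cumHazard_hazardQuantile ht0]; exact hst)).2
  rw [hG.cumHazard_hazardQuantile hs0', hG.cumHazard_hazardQuantile ht0] at h4
  have h5 := h4.symm.trans h3
  have hlt' := strictMonoOn_comp_hazardQuantile hG hTm hs0' ht0 hst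
  rw [← hC, hΨ _ _ (lt_comp_hazardQuantile hG hTm hTl hs0') hlt'] at h5
  refine mul_left_cancel₀ ?_ h5
  rw [hC]
  positivity

/-- An affine map sends the point dividing a hazard segment in a given ratio to the point dividing
its image in the same ratio, so the averages agree pointwise, for every admissible pair and not only
almost every one. -/
lemma regressionIdentity_of_affine
    (h : ∃ c > 0, ∀ z, 0 < z → T (hazardQuantile G z) = τ + c * z) :
    RegressionIdentity P (openRange G) (recVal Y m) (recVal Y (m + a + 1 + b + 1))
      (recVal Y (m + a + 1)) (fun y => f (T y)) fun s t => C * Ψ (T s) (T t) := by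
  obtain ⟨c, hc, h⟩ := h
  rw [regressionIdentity_recVal_iff hY hi hPμ hG hμ]
  refine ae_of_all _ fun p hs ht hst => ?_
  have hTs := apply_eq_of_affine hG hTm h hs
  have hTt := apply_eq_of_affine hG hTm h ht
  have hTst := hTm hs ht hst
  have hlt : cumHazard G p.1 < cumHazard G p.2 := by
    rw [hTs, hTt] at hTst
    exact lt_of_mul_lt_mul_left (by linarith) hc.le
  have h1 := integral_recordKernel_comp hG hTc hTm hTl a b hf hs hlt
  refine ⟨h1.1, h1.2.trans ?_⟩
  rw [hΨ _ _ (lt_apply_of_mem_openRange hG hTm hTl hs) hTst, hC]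
  congr 1
  refine intervalIntegral.integral_congr fun x hx => ?_
  rw [uIcc_of_le zero_le_one] at hx
  simp only
  rw [h _ (segment_mem (hG.cumHazard_pos hs) (hG.cumHazard_pos ht) hx), hTs, hTt]
  congr 2
  ring

end regression

lemma isContCDF_of_forall_eq {μ : Measure ℝ} [IsProbabilityMeasure μ] {G : ℝ → ℝ}
    (hμ : ∀ y, G y = μ.real (Iic y)) (hG : Continuous G) : IsContCDF G := by
  have h : G = cdf μ := by
    ext y; rw [hμ, cdf_eq_real]
  refine ⟨?_, hG, ?_, ?_⟩
  · rw [h]; exact monotone_cdf μ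
  · rw [h]; exact tendsto_cdf_atBot μ
  · rw [h]; exact tendsto_cdf_atTop μ

lemma ContDiffOn.deriv_Ioi {τ : ℝ} {n : ℕ} {h : ℝ → ℝ}
    (hh : ContDiffOn ℝ (n + 1 : ℕ) h (Ioi τ)) : ContDiffOn ℝ n (deriv h) (Ioi τ) :=
  ((contDiffOn_succ_iff_deriv_of_isOpen (n := n) isOpen_Ioi).1 (by exact_mod_cast hh)).2.2

lemma NonzeroRightLimit.congr {φ₁ φ₂ : ℝ → ℝ} {τ : ℝ} (h : NonzeroRightLimit φ₁ τ)
    (he : φ₁ =ᶠ[𝓝[>] τ] φ₂) : NonzeroRightLimit φ₂ τ := by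
  obtain ⟨L, hL, hL'⟩ := h
  exact ⟨L, hL, hL'.congr' (he.mono fun u hu => by rw [hu])⟩

end records_and_beta_averages

/-! ### The characterisation theorem -/

theorem theorem3 {Ω : Type*} [MeasurableSpace Ω] (P : Measure Ω) [IsProbabilityMeasure P]
    -- independent copies of a random variable with continuous distribution function `G`
    (Y : ℕ → Ω → ℝ) (hYm : ∀ i, Measurable (Y i)) (hYi : iIndepFun Y P)
    (G : ℝ → ℝ) (hYG : ∀ i y, G y = P.real {ω | Y i ω ≤ y}) (hG : Continuous G)
    -- the monotone transformation
    (T : ℝ → ℝ) (τ : ℝ) (hTc : ContinuousOn T (openRange G)) (hTm : StrictMonoOn T (openRange G))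
    (hTl : Tendsto T (comap Real.toEReal (𝓝[>] (leftExtremity G))) (𝓝 τ))
    (hTr : Tendsto T (comap Real.toEReal (𝓝[<] (rightExtremity G))) atTop) :
    -- part A
    (∀ (n k : ℕ) (h : ℝ → ℝ), 1 ≤ k → k ≤ n - 1 →
      ContDiffOn ℝ (k : ℕ) h (Ioi τ) →
      (∀ t ∈ openRange G, NonzeroRightLimit (fun u => quotDeriv h 0 k u (T t)) τ) →
      (RegressionIdentity P (openRange G)
          (recordValue Y (n - k)) (recordValue Y (n + 1)) (recordValue Y n)
          (fun y => iteratedDeriv k h (T y))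
          (fun s t => k * quotDeriv h 0 (k - 1) (T s) (T t))
        ↔ ∃ c : ℝ, 0 < c ∧ ∀ y ∈ openRange G, G y = 1 - Real.exp (-c * (T y - τ)))) ∧
    -- part B
    (∀ (n k r : ℕ) (h : ℝ → ℝ), 2 ≤ r → 2 ≤ k → k ≤ n - 1 →
      ContDiffOn ℝ (k + r - 1 : ℕ) h (Ioi τ) →
      (∀ t ∈ openRange G, NonzeroRightLimit (fun u => quotDeriv h r (k - 1) u (T t)) τ) →
      ((RegressionIdentity P (openRange G)
          (recordValue Y (n - k)) (recordValue Y (n + r)) (recordValue Y n)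
          (fun y => iteratedDeriv (k + r - 1) h (T y))
          (fun s t => ((k + r - 1).factorial : ℝ) / ((k - 1).factorial * (r - 1).factorial) *
            quotDeriv h (r - 1) (k - 1) (T s) (T t)) ∧
        RegressionIdentity P (openRange G)
          (recordValue Y (n - k + 1)) (recordValue Y (n + r)) (recordValue Y n)
          (fun y => iteratedDeriv (k + r - 1) h (T y))
          (fun s t => ((k + r - 2).factorial : ℝ) / ((k - 2).factorial * (r - 1).factorial) *
            quotDeriv (deriv h) (r - 1) (k - 2) (T s) (T t)))
        ↔ ∃ c : ℝ, 0 < c ∧ ∀ y ∈ openRange G, G y = 1 - Real.exp (-c * (T y - τ)))) := by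
  have hμ : ∀ i y, G y = (P.map (Y i)).real (Iic y) := fun i y => by
    rw [hYG i, map_measureReal_apply (hYm i) measurableSet_Iic]; rfl
  have hprob : ∀ i, IsProbabilityMeasure (P.map (Y i)) := fun i =>
    Measure.isProbabilityMeasure_map (hYm i).aemeasurable
  have hC : IsContCDF G := isContCDF_of_forall_eq (hμ 0) hG
  have hPμ : ∀ i, P.map (Y i) = P.map (Y 0) := fun i =>
    Measure.ext_of_Iic _ _ fun y => (measureReal_eq_measureReal_iff).1 ((hμ i y).symm.trans (hμ 0 y))
  have hiff := exists_affine_iff_exists_exponential (τ := τ) hC hTm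
  have hθm := strictMonoOn_comp_hazardQuantile hC hTm
  have hθτ : ∀ z, 0 < z → τ < T (hazardQuantile G z) := fun z hz =>
    lt_comp_hazardQuantile hC hTm hTl hz
  have hθ0 := tendsto_comp_hazardQuantile_zero hC hTl
  constructor
  · intro n k h hk hkn hh hne
    -- The beta exponents are `a = k - 1` and `b = r - 1 = 0`. As `recVal` counts from zero, `m = n
    -- - k - 1` is the index of the record `Y(n - k)`.
    obtain ⟨a, rfl⟩ : ∃ a, k = a + 1 := ⟨k - 1, by omega⟩
    obtain ⟨m, rfl⟩ : ∃ m, n = m + a + 1 + 1 := ⟨n - 1 - a - 1, by omega⟩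
    have hf : ContinuousOn (iteratedDeriv (a + 1) h) (Ioi τ) :=
      hh.continuousOn_iteratedDeriv_Ioi le_rfl
    have hΨ : ∀ u v, τ < u → u < v → quotDeriv h 0 a u v =
        betaAvg a 0 (iteratedDeriv (a + 1) h) u v := fun u v hu huv => by
      rw [quotDeriv_eq_betaAvg hh (by omega) hu (hu.trans huv) huv.ne, zero_add]
    have hcst : ((a + 1 : ℕ) : ℝ) = ((a + 0 + 1).factorial : ℝ) / (a.factorial * (0 : ℕ).factorial) := by
      rw [Nat.factorial_succ]
      push_cast
      simp
      field_simp
    have e1 : recordValue Y (m + a + 1 + 1 - (a + 1)) = recVal Y m := by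
      funext ω
      simp only [recordValue, recVal]
      rw [show m + a + 1 + 1 - (a + 1) - 1 = m by omega]
    have e2 : recordValue Y (m + a + 1 + 1 + 1) = recVal Y (m + a + 1 + 0 + 1) := rfl
    have e3 : recordValue Y (m + a + 1 + 1) = recVal Y (m + a + 1) := rfl
    rw [e1, e2, e3, Nat.add_sub_cancel, ← hiff]
    refine ⟨fun hreg => ?_, fun haff => ?_⟩
    · refine affine_of_betaAvg_comp_right hf hθm hθτ hθ0 a (fun v hv => ?_) fun p z hp hpz =>
        betaAvg_comp_eq_of_regressionIdentity hYm hYi hPμ hC (hμ 0) hTc hTm hTl m a 0 hf hcst hΨ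
          hreg hp hpz
      obtain ⟨t, ht, rfl⟩ := exists_apply_eq_of_lt hC hTc hTl hTr hv
      refine (hne t ht).congr ?_
      filter_upwards [Ioo_mem_nhdsGT hv] with u hu
      exact quotDeriv_succ_right_eq_deriv_betaAvg hh le_rfl hu.1 hv hu.2.ne
    · exact regressionIdentity_of_affine hYm hYi hPμ hC (hμ 0) hTc hTm hTl m a 0 hf hcst hΨ haff
  · intro n k r h hr hk hkn hh hne
    -- The first identity has exponents `(k - 1, r - 1) = (a + 1, b)`; the second starts one record
    -- later, at `m + 1`, with exponents `(a, b)`.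
    obtain ⟨a, rfl⟩ : ∃ a, k = a + 2 := ⟨k - 2, by omega⟩
    obtain ⟨b, rfl⟩ : ∃ b, r = b + 1 := ⟨r - 1, by omega⟩
    obtain ⟨m, rfl⟩ : ∃ m, n = m + (a + 1) + 1 + 1 := ⟨n - 1 - (a + 1) - 1, by omega⟩
    rw [show a + 2 + (b + 1) - 1 = b + (a + 1) + 1 by omega] at hh
    have hf : ContinuousOn (iteratedDeriv (b + (a + 1) + 1) h) (Ioi τ) :=
      hh.continuousOn_iteratedDeriv_Ioi le_rfl
    have hΨ : ∀ u v, τ < u → u < v → quotDeriv h b (a + 1) u v =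
        betaAvg (a + 1) b (iteratedDeriv (b + (a + 1) + 1) h) u v := fun u v hu huv =>
      quotDeriv_eq_betaAvg hh le_rfl hu (hu.trans huv) huv.ne
    -- Replacing `h` by its derivative offsets the lower order of differentiation, so both
    -- identities average the same function.
    have hΨ' : ∀ u v, τ < u → u < v → quotDeriv (deriv h) b a u v =
        betaAvg a b (iteratedDeriv (b + (a + 1) + 1) h) u v := fun u v hu huv => by
      rw [quotDeriv_eq_betaAvg (n := b + a + 1) (ContDiffOn.deriv_Ioi hh) le_rfl hu (hu.trans huv)
        huv.ne, ← iteratedDeriv_succ']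
      rfl
    have e1 : recordValue Y (m + (a + 1) + 1 + 1 - (a + 2)) = recVal Y m := by
      funext ω
      simp only [recordValue, recVal]
      rw [show m + (a + 1) + 1 + 1 - (a + 2) - 1 = m by omega]
    have e1' : recordValue Y (m + (a + 1) + 1 + 1 - (a + 2) + 1) = recVal Y (m + 1) := by
      funext ω
      simp only [recordValue, recVal]
      rw [show m + (a + 1) + 1 + 1 - (a + 2) + 1 - 1 = m + 1 by omega]
    have e2 : recordValue Y (m + (a + 1) + 1 + 1 + (b + 1)) =
        recVal Y (m + (a + 1) + 1 + b + 1) := by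
      funext ω
      simp only [recordValue, recVal]
      rw [show m + (a + 1) + 1 + 1 + (b + 1) - 1 = m + (a + 1) + 1 + b + 1 by omega]
    have e2' : m + 1 + a + 1 + b + 1 = m + (a + 1) + 1 + b + 1 := by ring
    have e3 : recordValue Y (m + (a + 1) + 1 + 1) = recVal Y (m + (a + 1) + 1) := rfl
    have e3' : m + 1 + a + 1 = m + (a + 1) + 1 := by ring
    rw [e1, e1', e2, e3, show a + 2 + (b + 1) - 1 = b + (a + 1) + 1 by omega,
      show a + 2 + (b + 1) - 2 = a + b + 1 by omega, show a + 2 - 1 = a + 1 by omega,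
      Nat.add_sub_cancel, Nat.add_sub_cancel, ← hiff]
    have hcst : ((b + (a + 1) + 1).factorial : ℝ) / ((a + 1).factorial * b.factorial) =
        ((a + 1 + b + 1).factorial : ℝ) / ((a + 1).factorial * b.factorial) := by
      rw [show b + (a + 1) + 1 = a + 1 + b + 1 by ring]
    refine ⟨fun hreg => ?_, fun haff => ⟨?_, ?_⟩⟩
    · refine affine_of_betaAvg_comp_left hf hθm hθτ hθ0 a b (fun v hv => ?_) (fun p z hp hpz => ?_)
        fun p z hp hpz => ?_
      · obtain ⟨t, ht, rfl⟩ := exists_apply_eq_of_lt hC hTc hTl hTr hv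
        refine (hne t ht).congr ?_
        filter_upwards [Ioo_mem_nhdsGT hv] with u hu
        exact quotDeriv_succ_left_eq_deriv_betaAvg hh le_rfl hu.1 hv hu.2.ne
      · exact betaAvg_comp_eq_of_regressionIdentity hYm hYi hPμ hC (hμ 0) hTc hTm hTl m (a + 1) b
          hf hcst hΨ hreg.1 hp hpz
      · refine betaAvg_comp_eq_of_regressionIdentity hYm hYi hPμ hC (hμ 0) hTc hTm hTl (m + 1) a b
          hf rfl hΨ' ?_ hp hpz
        rw [e2', e3']
        exact hreg.2
    · exact regressionIdentity_of_affine hYm hYi hPμ hC (hμ 0) hTc hTm hTl m (a + 1) b hf hcst hΨ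
        haff
    · have := regressionIdentity_of_affine hYm hYi hPμ hC (hμ 0) hTc hTm hTl (m + 1) a b hf rfl hΨ'
        haff
      rwa [e2', e3'] at this
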